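/- Let $\Bbbk$ be a field of characteristic $0$, let $n\ge 4$, and let $A_n=\Bbbk[x_1,\dots,x_{n-1}]/(x_1,\dots,x_{n-1})^2$, a $\Bbbk$-algebra of rank $n$. For $a\in A_n$ and $1\le i\le n$ let $a^{(i)}\in A_n^{\otimes n}$ be the pure tensor with $a$ in position $i$ and $1$ elsewhere, let $e_j(a)$ be the $j$-th elementary symmetric function of $a^{(1)},\dots,a^{(n)}$, and let $\sum_{j=0}^n(-1)^js_j(a)t^{n-j}$ be the characteristic polynomial of multiplication by $a$ on $A_n$. The Galois closure of $A_n$ over $\Bbbk$ is $$G(A_n)=A_n^{\otimes n}\big/\big(s_j(a)-e_j(a)\ \big|\ a\in A_n,\ 1\le j\le n\big),$$ with the action of $S_n$ that permutes the tensor factors. Put $x_{i,j}=x_i^{(j)}$ for $1\le i\le n-1$ and $1\le j\le n$. These elements generate $G(A_n)$, which is graded by total degree, each $x_{i,j}$ having degree $1$, and by multidegree $d=(d_1,\dots,d_{n-1})$, where $x_{i,j}$ has the $i$-th unit vector as its multidegree; $G(A_n)_d$ denotes the component of multidegree $d$. The socle of $G(A_n)$ is the annihilator of its maximal ideal $(x_{i,j})_{i,j}$.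 For a partition $\mu$ of $n$ let $V_\mu$ be the Specht module of $S_n$ over $\Bbbk$. Let $D=\lceil n/2\rceil$, and let $\mu=(D,D)$ if $n$ is even and $\mu=(D-1,D-1,1)$ if $n$ is odd. Then: 1. The least degree in which $G(A_n)$ has a nonzero homogeneous socle element is $D$; that is, there is a nonzero socle element that is homogeneous of total degree $D$, and there is none of total degree less than $D$. 2. For every $d=(d_1,\dots,d_{n-1})\in\mathbb{Z}_{\ge0}^{n-1}$ with $\sum_i d_i=D$, every $S_n$-subrepresentation of $G(A_n)_d$ that is isomorphic to $V_\mu$ is contained in the socle of $G(A_n)$. -/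

import Mathlib

noncomputable section

namespace GaloisClosure

section General

variable (B A : Type*) [CommRing B] [CommRing A] [Algebra B A]

/-- The `n`-fold tensor power `A ⊗ ⋯ ⊗ A` over `B`. -/
abbrev TensorPow (n : ℕ) : Type _ := PiTensorProduct B (fun _ : Fin n => A)

variable {A}

/-- `a⁽ⁱ⁾ = 1 ⊗ ⋯ ⊗ a ⊗ ⋯ ⊗ 1`, with `a` in position `i`. -/
def conj {n : ℕ} (i : Fin n) (a : A) : TensorPow B A n :=
  PiTensorProduct.singleAlgHom (R := B) (A := fun _ : Fin n => A) i a

/-- `e_j(a)`: the `j`-th elementary symmetric function in `a⁽¹⁾, …, a⁽ⁿ⁾`. -/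
def conjEsymm (n j : ℕ) (a : A) : TensorPow B A n :=
  MvPolynomial.aeval (fun i => conj B i a) (MvPolynomial.esymm (Fin n) B j)

/-- `s_j(a)`, where `∑ⱼ (-1)ʲ s_j(a) t^(n-j)` is the characteristic polynomial of multiplication
by `a` on the `B`-algebra `A`, free of rank `n` (used for `j ≤ n`). -/
def charCoeff [Module.Free B A] [Module.Finite B A] (n j : ℕ) (a : A) : B :=
  (-1) ^ j * (LinearMap.charpoly (LinearMap.mulLeft B a)).coeff (n - j)

variable (A)

/-- The ideal of `A ⊗ ⋯ ⊗ A` generated by all `s_j(a) - e_j(a)`, for `a ∈ A` and `1 ≤ j ≤ n`. -/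
def relIdeal [Module.Free B A] [Module.Finite B A] (n : ℕ) : Ideal (TensorPow B A n) :=
  Ideal.span {z | ∃ (a : A) (j : ℕ), 1 ≤ j ∧ j ≤ n ∧
    z = algebraMap B (TensorPow B A n) (charCoeff B n j a) - conjEsymm B n j a}

/-- The Galois closure `G(A/B)` of a `B`-algebra `A` that is free of rank `n` over `B`. -/
abbrev Closure [Module.Free B A] [Module.Finite B A] (n : ℕ) : Type _ :=
  TensorPow B A n ⧸ relIdeal B A n

/-- Permutation of the tensor factors: `σ` sends `a⁽ⁱ⁾` to `a⁽ʲ⁾` with `j = σ i`. -/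
def permTensor {n : ℕ} (σ : Equiv.Perm (Fin n)) : TensorPow B A n →ₐ[B] TensorPow B A n :=
  PiTensorProduct.liftAlgHom
    ((PiTensorProduct.tprod B (s := fun _ : Fin n => A)).domDomCongr σ⁻¹)
    PiTensorProduct.one_def.symm (fun _ _ => (PiTensorProduct.tprod_mul_tprod _ _).symm)

theorem permTensor_tprod {n : ℕ} (σ : Equiv.Perm (Fin n)) (x : Fin n → A) :
    permTensor B A σ (PiTensorProduct.tprod B x) =
      PiTensorProduct.tprod B (fun i => x (σ⁻¹ i)) := by
  exact PiTensorProduct.lift.tprod (φ := (PiTensorProduct.tprod B).domDomCongr σ⁻¹) x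

theorem permTensor_conj {n : ℕ} (σ : Equiv.Perm (Fin n)) (i : Fin n) (a : A) :
    permTensor B A σ (conj B i a) = conj B (σ i) a := by
  rw [conj, PiTensorProduct.singleAlgHom_apply, permTensor_tprod, conj,
    PiTensorProduct.singleAlgHom_apply]
  congr 1
  funext j
  simp only [MonoidHom.mulSingle_apply, Pi.mulSingle_apply]
  have h : σ⁻¹ j = i ↔ j = σ i := Equiv.Perm.inv_eq_iff_eq
  simp only [h]

theorem permTensor_conjEsymm {n : ℕ} (σ : Equiv.Perm (Fin n)) (j : ℕ) (a : A) :
    permTensor B A σ (conjEsymm B n j a) = conjEsymm B n j a := by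
  have h1 : permTensor B A σ (conjEsymm B n j a) =
      MvPolynomial.aeval (fun i => conj B (σ i) a) (MvPolynomial.esymm (Fin n) B j) := by
    rw [conjEsymm, ← AlgHom.comp_apply, MvPolynomial.comp_aeval]
    simp only [permTensor_conj]
  rw [h1, conjEsymm]
  conv_rhs => rw [← MvPolynomial.rename_esymm (Fin n) B j σ]
  rw [MvPolynomial.aeval_rename]
  rfl

theorem permTensor_one (n : ℕ) : permTensor B A (1 : Equiv.Perm (Fin n)) = AlgHom.id B _ := by
  apply PiTensorProduct.algHom_ext
  intro i
  ext a
  exact permTensor_conj B A 1 i a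

theorem permTensor_mul {n : ℕ} (σ τ : Equiv.Perm (Fin n)) :
    permTensor B A (σ * τ) = (permTensor B A σ).comp (permTensor B A τ) := by
  apply PiTensorProduct.algHom_ext
  intro i
  ext a
  change permTensor B A (σ * τ) (conj B i a) =
    permTensor B A σ (permTensor B A τ (conj B i a))
  rw [permTensor_conj, permTensor_conj, permTensor_conj]
  rfl

variable [Module.Free B A] [Module.Finite B A]

theorem relIdeal_le_comap {n : ℕ} (σ : Equiv.Perm (Fin n)) :
    relIdeal B A n ≤ (relIdeal B A n).comap (permTensor B A σ) := by
  rw [relIdeal, Ideal.span_le]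
  rintro _ ⟨a, j, h1, hn, rfl⟩
  change permTensor B A σ _ ∈ relIdeal B A n
  rw [map_sub, permTensor_conjEsymm, AlgHom.commutes]
  exact Ideal.subset_span ⟨a, j, h1, hn, rfl⟩

/-- The action of `σ ∈ Sₙ` on `G(A/B)`, induced by permuting the tensor factors. -/
def permClosure {n : ℕ} (σ : Equiv.Perm (Fin n)) : Closure B A n →ₐ[B] Closure B A n :=
  Ideal.quotientMapₐ (relIdeal B A n) (permTensor B A σ) (relIdeal_le_comap B A σ)

/-- The representation of `Sₙ` on `G(A/B)`. -/
def closureRep (n : ℕ) : Representation B (Equiv.Perm (Fin n)) (Closure B A n) where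
  toFun σ := (permClosure B A σ).toLinearMap
  map_one' := by
    apply LinearMap.ext
    intro x
    obtain ⟨x, rfl⟩ := Ideal.Quotient.mk_surjective x
    change Ideal.Quotient.mk _ (permTensor B A 1 x) = Ideal.Quotient.mk _ x
    rw [permTensor_one]
    rfl
  map_mul' σ τ := by
    apply LinearMap.ext
    intro x
    obtain ⟨x, rfl⟩ := Ideal.Quotient.mk_surjective x
    change Ideal.Quotient.mk _ (permTensor B A (σ * τ) x) =
      Ideal.Quotient.mk _ (permTensor B A σ (permTensor B A τ x))
    rw [permTensor_mul]
    rfl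

end General

section Special

variable (k : Type*) [Field k] (n : ℕ)

/-- `A_n = k[x₁, …, x_{n-1}] / (x₁, …, x_{n-1})²`. -/
abbrev AlgA : Type _ :=
  MvPolynomial (Fin (n - 1)) k ⧸ (MvPolynomial.idealOfVars (Fin (n - 1)) k) ^ 2

/-- The class of the variable `x_i` in `A_n`. -/
def varA (i : Fin (n - 1)) : AlgA k n :=
  Ideal.Quotient.mk _ (MvPolynomial.X i)

theorem varA_mul_varA (i j : Fin (n - 1)) : varA k n i * varA k n j = 0 := by
  rw [varA, varA, ← map_mul, Ideal.Quotient.eq_zero_iff_mem, pow_two]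
  exact Ideal.mul_mem_mul (Ideal.subset_span ⟨i, rfl⟩) (Ideal.subset_span ⟨j, rfl⟩)

instance finite_algA : Module.Finite k (AlgA k n) := by
  classical
  refine ⟨⟨insert 1 (Finset.univ.image (varA k n)), ?_⟩⟩
  rw [eq_top_iff]
  rintro x -
  obtain ⟨p, rfl⟩ := Ideal.Quotient.mk_surjective x
  induction p using MvPolynomial.induction_on with
  | C a =>
    have h : Ideal.Quotient.mk ((MvPolynomial.idealOfVars (Fin (n - 1)) k) ^ 2)
        (MvPolynomial.C a) = a • (1 : AlgA k n) := by
      rw [Algebra.smul_def, mul_one]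
      rfl
    rw [h]
    exact Submodule.smul_mem _ _ (Submodule.subset_span (by simp))
  | add p q hp hq => rw [map_add]; exact Submodule.add_mem _ hp hq
  | mul_X p i hp =>
    rw [map_mul]
    change _ * varA k n i ∈ _
    refine Submodule.span_induction (p := fun y _ => y * varA k n i ∈ _) ?_ ?_ ?_ ?_ hp
    · intro y hy
      simp only [Finset.coe_insert, Finset.coe_image, Finset.coe_univ, Set.image_univ,
        Set.mem_insert_iff, Set.mem_range] at hy
      rcases hy with rfl | ⟨j, rfl⟩
      · rw [one_mul]
        exact Submodule.subset_span (by simp)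
      · rw [varA_mul_varA]
        exact Submodule.zero_mem _
    · rw [zero_mul]
      exact Submodule.zero_mem _
    · intro y z _ _ hy hz
      rw [add_mul]
      exact Submodule.add_mem _ hy hz
    · intro c y _ hy
      rw [smul_mul_assoc]
      exact Submodule.smul_mem _ _ hy

/-- `G(A_n) = G(A_n/k)`. -/
abbrev GA : Type _ := Closure k (AlgA k n) n

/-- The representation of `Sₙ` on `G(A_n)`; it satisfies `σ x_{i,j} = x_{i,σ(j)}`. -/
def GArep : Representation k (Equiv.Perm (Fin n)) (GA k n) := closureRep k (AlgA k n) n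

/-- The element `x_{i,j} = x_i⁽ʲ⁾` of `G(A_n)`. -/
def x (i : Fin (n - 1)) (j : Fin n) : GA k n :=
  Ideal.Quotient.mk (relIdeal k (AlgA k n) n) (conj k j (varA k n i))

theorem GArep_x (σ : Equiv.Perm (Fin n)) (i : Fin (n - 1)) (j : Fin n) :
    GArep k n σ (x k n i j) = x k n i (σ j) := by
  change Ideal.Quotient.mk _ (permTensor k (AlgA k n) σ _) = _
  rw [permTensor_conj]
  rfl

/-- The presentation `k[x_{i,j}] → G(A_n)`. -/
def pres : MvPolynomial (Fin (n - 1) × Fin n) k →ₐ[k] GA k n :=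
  MvPolynomial.aeval (fun p => x k n p.1 p.2)

/-- The component `G(A_n)_d` of multidegree `d = (d₁, …, d_{n-1})`, where `x_{i,j}` has as its
multidegree the `i`-th unit vector. -/
def multiPart (d : Fin (n - 1) → ℕ) : Submodule k (GA k n) :=
  (MvPolynomial.weightedHomogeneousSubmodule k
    (fun p : Fin (n - 1) × Fin n => (Pi.single p.1 1 : Fin (n - 1) → ℕ)) d).map
    (pres k n).toLinearMap

/-- The component of `G(A_n)` of total degree `e`, where every `x_{i,j}` has degree `1`. -/
def degPart (e : ℕ) : Submodule k (GA k n) :=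
  (MvPolynomial.homogeneousSubmodule (Fin (n - 1) × Fin n) k e).map (pres k n).toLinearMap

/-- The maximal ideal of the local Artinian ring `G(A_n)`, generated by all `x_{i,j}`. -/
def maxIdeal : Ideal (GA k n) :=
  Ideal.span (Set.range fun p : Fin (n - 1) × Fin n => x k n p.1 p.2)

/-- The socle of `G(A_n)`: the elements annihilated by the maximal ideal. -/
def socle : Ideal (GA k n) := Submodule.annihilator (maxIdeal k n)

end Special

end GaloisClosure

namespace SpechtModule

/-- Tableaux of shape `μ` with entries `0, …, n-1`, each occurring once. -/
abbrev Tableau (μ : YoungDiagram) (n : ℕ) : Type := μ.cells ≃ Fin n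

section

variable {μ : YoungDiagram} {n : ℕ}

/-- The row of the tableau `t` that contains the entry `a`. -/
def rowOf (t : Tableau μ n) (a : Fin n) : ℕ := (t.symm a).1.1

/-- The column of the tableau `t` that contains the entry `a`. -/
def colOf (t : Tableau μ n) (a : Fin n) : ℕ := (t.symm a).1.2

variable (μ n) in
/-- Row equivalence: corresponding rows of the two tableaux contain the same entries. -/
def rowSetoid : Setoid (Tableau μ n) := Setoid.ker rowOf

variable (μ n) in
/-- Tabloids of shape `μ`: row equivalence classes of tableaux. -/
def Tabloid : Type := Quotient (rowSetoid μ n)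

/-- The tabloid `{t}` of a tableau `t`. -/
def Tabloid.mk (t : Tableau μ n) : Tabloid μ n := Quotient.mk (rowSetoid μ n) t

/-- The tableau `σ t`, obtained by applying `σ` to the entries of `t`. -/
def act (σ : Equiv.Perm (Fin n)) (t : Tableau μ n) : Tableau μ n := t.trans σ

theorem rowOf_act (σ : Equiv.Perm (Fin n)) (t : Tableau μ n) :
    rowOf (act σ t) = fun a => rowOf t (σ⁻¹ a) := rfl

theorem colOf_act (σ : Equiv.Perm (Fin n)) (t : Tableau μ n) :
    colOf (act σ t) = fun a => colOf t (σ⁻¹ a) := rfl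

/-- `Sₙ` acts on tabloids by `σ {t} = {σ t}`. -/
instance tabloidAction : MulAction (Equiv.Perm (Fin n)) (Tabloid μ n) where
  smul σ := Quotient.map (act σ) (fun t t' (h : rowOf t = rowOf t') => by
    change rowOf (act σ t) = rowOf (act σ t')
    rw [rowOf_act, rowOf_act, h])
  one_smul := by rintro ⟨t⟩; rfl
  mul_smul := by rintro σ τ ⟨t⟩; rfl

theorem smul_mk (σ : Equiv.Perm (Fin n)) (t : Tableau μ n) :
    σ • Tabloid.mk t = Tabloid.mk (act σ t) := rfl

/-- The permutations that preserve every column of `t`. -/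
def colStabilizer (t : Tableau μ n) : Subgroup (Equiv.Perm (Fin n)) where
  carrier := {π | ∀ a, colOf t (π a) = colOf t a}
  one_mem' := fun _ => rfl
  mul_mem' := fun {π ρ} hπ hρ a => (hπ (ρ a)).trans (hρ a)
  inv_mem' := fun {π} hπ a => by simpa using (hπ (π⁻¹ a)).symm

end

section

variable (k : Type*) [Field k] (μ : YoungDiagram) (n : ℕ)

/-- The permutation module `M_μ` with basis the tabloids of shape `μ`. -/
abbrev permModule : Type _ := Tabloid μ n →₀ k

/-- The representation of `Sₙ` on `M_μ`. -/
def permRep : Representation k (Equiv.Perm (Fin n)) (permModule k μ n) where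
  toFun σ := Finsupp.lmapDomain k k (fun T => σ • T)
  map_one' := by
    ext T
    simp
  map_mul' σ τ := by
    ext T
    simp [mul_smul]

variable {μ n}

open Classical in
/-- The polytabloid `e_t = ∑ sgn(π) {π t}`, summed over the column stabilizer of `t`. -/
def polytabloid (t : Tableau μ n) : permModule k μ n :=
  ∑ π : colStabilizer t,
    Finsupp.single ((π : Equiv.Perm (Fin n)) • Tabloid.mk t)
      ((Equiv.Perm.sign (π : Equiv.Perm (Fin n)) : ℤ) : k)

theorem permRep_polytabloid (σ : Equiv.Perm (Fin n)) (t : Tableau μ n) :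
    permRep k μ n σ (polytabloid k t) = polytabloid k (act σ t) := by
  classical
  rw [polytabloid, polytabloid, map_sum]
  have key : ∀ π : Equiv.Perm (Fin n),
      π ∈ colStabilizer t ↔ σ * π * σ⁻¹ ∈ colStabilizer (act σ t) := by
    intro π
    change (∀ a, colOf t (π a) = colOf t a) ↔
      ∀ a, colOf t (σ⁻¹ (σ (π (σ⁻¹ a)))) = colOf t (σ⁻¹ a)
    simp only [Equiv.Perm.inv_def, Equiv.symm_apply_apply]
    exact ⟨fun h a => h _, fun h a => by simpa using h (σ a)⟩
  refine Fintype.sum_equiv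
    ((MulAut.conj σ).toEquiv.subtypeEquiv (fun π => key π)) _ _ ?_
  intro π
  change Finsupp.mapDomain _ _ = _
  rw [Finsupp.mapDomain_single]
  congr 1
  · rw [← smul_mk]
    change σ • ((π : Equiv.Perm (Fin n)) • Tabloid.mk t) =
      (σ * (π : Equiv.Perm (Fin n)) * σ⁻¹) • σ • Tabloid.mk t
    simp only [smul_smul]
    congr 1
    group
  · change _ = ((Equiv.Perm.sign (σ * (π : Equiv.Perm (Fin n)) * σ⁻¹) : ℤ) : k)
    have h : Equiv.Perm.sign (σ * (π : Equiv.Perm (Fin n)) * σ⁻¹) =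
        Equiv.Perm.sign (π : Equiv.Perm (Fin n)) := by
      rw [map_mul, map_mul, mul_right_comm, ← map_mul, mul_inv_cancel, map_one, one_mul]
    rw [h]

variable (μ n)

/-- The Specht module `V_μ`: the subrepresentation of `M_μ` spanned by the polytabloids. -/
def specht : Subrepresentation (permRep k μ n) where
  toSubmodule := Submodule.span k (Set.range (polytabloid k (μ := μ) (n := n)))
  apply_mem_toSubmodule σ v hv := by
    refine Submodule.span_induction
      (p := fun v _ => permRep k μ n σ v ∈ Submodule.span k (Set.range (polytabloid k)))
      ?_ ?_ ?_ ?_ hv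
    · rintro _ ⟨t, rfl⟩
      rw [permRep_polytabloid]
      exact Submodule.subset_span ⟨_, rfl⟩
    · rw [map_zero]
      exact Submodule.zero_mem _
    · intro y z _ _ hy hz
      rw [map_add]
      exact Submodule.add_mem _ hy hz
    · intro c y _ hy
      rw [map_smul]
      exact Submodule.smul_mem _ _ hy

end

end SpechtModule

namespace GaloisClosure

/-- `D = ⌈n/2⌉`. -/
def socleDegree (n : ℕ) : ℕ := (n + 1) / 2

/-- The partition `μ = (D, D)` of `n` for even `n`, and `μ = (D-1, D-1, 1)` for odd `n`. -/
def socleShape (n : ℕ) (hn : 4 ≤ n) : YoungDiagram :=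
  if Even n then
    YoungDiagram.ofRowLens [socleDegree n, socleDegree n] (by
      simp [List.sortedGE_iff_pairwise])
  else
    YoungDiagram.ofRowLens [socleDegree n - 1, socleDegree n - 1, 1] (by
      simp [List.sortedGE_iff_pairwise, socleDegree]
      omega)

end GaloisClosure

/-! In characteristic zero the defining relations of `G(A_n)` reduce to the linear ones `∑ⱼ x_{i,j}
= 0`: square-zero elements with sum zero have vanishing power sums, hence by Newton's identities
vanishing elementary symmetric functions (`relIdeal_eq`). The tensor power has a basis of words,
with one letter or a blank in each of `n` positions. So the dual of `G(A_n)` is the space of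
harmonic functions on words, and multiplication by `x_{i,j}` is dual to `del i j`.

Below degree `D`: the socle vanishes in degree `e` once every harmonic function of weight `e` is a
combination of functions `del i c t` with `t` harmonic. For `2e ≤ n` the harmonic functions of
weight `e` are spanned by products of antisymmetric pairs (`harmonic_mem_prodSpan`). Such a product
uses `2e` positions, so if `2e < n` some position `c` is free. Enlarging one pair to an
antisymmetrized triple through `c`, with a second letter, gives the required `t`
(`IsProd.exists_harmonic_del`).

In degree `D`: let `z` of degree `e` be invariant under a Young subgroup. Symmetrized words are
multiples of products of block sums, and the relations express the sum over one block through the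
positions outside it. If that block has `n - e` elements, `z` lies in the `e`-th power of an ideal
supported on `e` positions, whose next power is zero. Two such blocks therefore force `z` into the
socle (`mem_socle_of_invariant`). The first two rows of `μ` have length `n - D`, and by Maschke's
theorem every image of `V_μ` is spanned by invariants of row stabilizers. This gives the second
claim. Explicit invariant words, detected by products of pairs or by a triple, show that the socle
is nonzero in degree `D`. -/

noncomputable section

namespace GaloisClosure

/-! ### Harmonic functions on words and products of antisymmetric pairs. -/

section Words

set_option linter.unusedSectionVars false

variable {k L P : Type*} [Field k] [DecidableEq L] [DecidableEq P]

/-- Changing the letter `none` in position `j` into `some i`, on functions on words: the transpose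
of `word ↦ word with i written in position j`. -/
def del (i : L) (j : P) : ((P → Option L) → k) →ₗ[k] ((P → Option L) → k) where
  toFun φ u := if u j = none then φ (Function.update u j (some i)) else 0
  map_add' φ ψ := by
    ext u
    by_cases h : u j = none <;> simp [h]
  map_smul' c φ := by
    ext u
    by_cases h : u j = none <;> simp [h]

/-- The adjoint of `del a j`. -/
def ins (a : L) (j : P) : ((P → Option L) → k) →ₗ[k] ((P → Option L) → k) where
  toFun φ u := if u j = some a then φ (Function.update u j none) else 0
  map_add' φ ψ := by
    ext u
    by_cases h : u j = some a <;> simp [h]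
  map_smul' c φ := by
    ext u
    by_cases h : u j = some a <;> simp [h]

theorem del_apply (i : L) (j : P) (φ : (P → Option L) → k) (u : P → Option L) :
    del i j φ u = if u j = none then φ (Function.update u j (some i)) else 0 := rfl

theorem ins_apply (a : L) (j : P) (φ : (P → Option L) → k) (u : P → Option L) :
    ins a j φ u = if u j = some a then φ (Function.update u j none) else 0 := rfl

/-- The functions on words that vanish on every word with a letter in position `j`. -/
def Avoids (φ : (P → Option L) → k) (j : P) : Prop := ∀ u, u j ≠ none → φ u = 0

/-- The number of letters of a word. -/
def wt [Fintype P] (u : P → Option L) : ℕ := (Finset.univ.filter fun j => u j ≠ none).card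

/-- The functions on words that vanish outside the words with `e` letters. -/
def HasWt [Fintype P] (φ : (P → Option L) → k) (e : ℕ) : Prop := ∀ u, wt u ≠ e → φ u = 0

variable (k L P) in
/-- The functions annihilated by all `∑ⱼ del i j`. -/
def harmonic [Fintype P] : Submodule k ((P → Option L) → k) :=
  ⨅ i : L, LinearMap.ker (∑ j : P, del i j)

theorem mem_harmonic [Fintype P] {φ : (P → Option L) → k} :
    φ ∈ harmonic k L P ↔ ∀ i : L, ∑ j : P, del i j φ = 0 := by
  simp [harmonic, Submodule.mem_iInf, LinearMap.sum_apply]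

theorem del_comm (i i' : L) {j j' : P} (h : j ≠ j') (φ : (P → Option L) → k) :
    del i j (del i' j' φ) = del i' j' (del i j φ) := by
  ext u
  simp only [del_apply, Function.update_of_ne h, Function.update_of_ne h.symm]
  split_ifs <;> first | rfl | rw [Function.update_comm h]

theorem del_del_self (i i' : L) (j : P) (φ : (P → Option L) → k) :
    del i j (del i' j φ) = 0 := by
  ext u
  simp [del_apply]

theorem del_ins_comm (i a : L) {j j' : P} (h : j ≠ j') (φ : (P → Option L) → k) :
    del i j (ins a j' φ) = ins a j' (del i j φ) := by
  ext u
  simp only [del_apply, ins_apply, Function.update_of_ne h, Function.update_of_ne h.symm]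
  split_ifs <;> first | rfl | rw [Function.update_comm h]

theorem del_ins_self (i : L) {j : P} {φ : (P → Option L) → k} (h : Avoids φ j) :
    del i j (ins i j φ) = φ := by
  ext u
  rw [del_apply, ins_apply]
  split_ifs with h1 h2
  · rw [Function.update_idem, ← h1, Function.update_eq_self]
  · simp at h2
  · exact (h u h1).symm

theorem del_ins_ne {i a : L} (hia : i ≠ a) (j : P) (φ : (P → Option L) → k) :
    del i j (ins a j φ) = 0 := by
  ext u
  simp [del_apply, ins_apply, hia]

theorem Avoids.del_eq_zero {j : P} {φ : (P → Option L) → k} (h : Avoids φ j) (i : L) :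
    del i j φ = 0 := by
  ext u
  rw [del_apply]
  split_ifs
  · exact h _ (by simp)
  · rfl

theorem avoids_del (i : L) (j : P) (φ : (P → Option L) → k) : Avoids (del i j φ) j :=
  fun _ hu => if_neg hu

theorem Avoids.del {j : P} {φ : (P → Option L) → k} (h : Avoids φ j) (i : L) (j' : P) :
    Avoids (del i j' φ) j := by
  by_cases hj : j = j'
  · subst hj
    exact avoids_del i j φ
  · intro u hu
    rw [del_apply, h (Function.update u j' (some i)) (by rwa [Function.update_of_ne hj]), ite_self]

theorem Avoids.ins {j : P} {φ : (P → Option L) → k} (h : Avoids φ j) (i : L) {j' : P}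
    (hj : j ≠ j') : Avoids (ins i j' φ) j := by
  intro u hu
  rw [ins_apply, h (Function.update u j' none) (by rwa [Function.update_of_ne hj]), ite_self]

theorem Avoids.sub {j : P} {φ ψ : (P → Option L) → k} (h : Avoids φ j) (h' : Avoids ψ j) :
    Avoids (φ - ψ) j := fun u hu => by simp [h u hu, h' u hu]

theorem Avoids.add {j : P} {φ ψ : (P → Option L) → k} (h : Avoids φ j) (h' : Avoids ψ j) :
    Avoids (φ + ψ) j := fun u hu => by simp [h u hu, h' u hu]

theorem Avoids.smul {j : P} {φ : (P → Option L) → k} (h : Avoids φ j) (c : k) :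
    Avoids (c • φ) j := fun u hu => by simp [h u hu]

variable [Fintype P]

theorem wt_update_some {u : P → Option L} {j : P} (h : u j = none) (i : L) :
    wt (Function.update u j (some i)) = wt u + 1 := by
  have : (Finset.univ.filter fun l => Function.update u j (some i) l ≠ none) =
      insert j (Finset.univ.filter fun l => u l ≠ none) := by
    ext l
    by_cases hl : l = j
    · subst hl; simp
    · simp [hl]
  rw [wt, this, Finset.card_insert_of_notMem (by simp [h]), wt]

theorem wt_update_none {u : P → Option L} {j : P} (h : u j ≠ none) :
    wt (Function.update u j none) + 1 = wt u := by
  obtain ⟨a, ha⟩ := Option.ne_none_iff_exists'.mp h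
  rw [← wt_update_some (u := Function.update u j none) (j := j) (by simp) a,
    Function.update_idem, ← ha, Function.update_eq_self]

theorem HasWt.del {φ : (P → Option L) → k} {e : ℕ} (h : HasWt φ (e + 1)) (i : L) (j : P) :
    HasWt (del i j φ) e := by
  intro u hu
  rw [del_apply]
  split_ifs with h1
  · exact h _ (by rw [wt_update_some h1]; omega)
  · rfl

theorem HasWt.ins {φ : (P → Option L) → k} {e : ℕ} (h : HasWt φ e) (i : L) (j : P) :
    HasWt (ins i j φ) (e + 1) := by
  intro u hu
  rw [ins_apply]
  split_ifs with h1
  · have := wt_update_none (u := u) (j := j) (by simp [h1])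
    exact h _ (by omega)
  · rfl

theorem HasWt.sub {φ ψ : (P → Option L) → k} {e : ℕ} (h : HasWt φ e) (h' : HasWt ψ e) :
    HasWt (φ - ψ) e := fun u hu => by simp [h u hu, h' u hu]

/-- Operators at distinct positions commute, so only the term at position `j` needs care.
Harmonicity turns the sum over the other positions into `-del i' j φ`, which `del i j` kills. -/
theorem del_mem_harmonic {φ : (P → Option L) → k} (h : φ ∈ harmonic k L P) (i : L) (j : P) :
    del i j φ ∈ harmonic k L P := by
  rw [mem_harmonic] at h ⊢
  intro i'
  have h2 : ∀ j' : P, del i' j' (del i j φ) =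
      del i j (if j' = j then (0 : (P → Option L) → k) else del i' j' φ) := by
    intro j'
    split_ifs with hj
    · subst hj; rw [del_del_self, map_zero]
    · exact del_comm _ _ hj _
  rw [Finset.sum_congr rfl fun j' _ => h2 j', ← map_sum (del i j), Finset.sum_ite,
    Finset.sum_const_zero, zero_add]
  have h3 : ∑ j' ∈ Finset.univ.filter (fun j' => ¬ j' = j), del i' j' φ = - del i' j φ := by
    rw [eq_neg_iff_add_eq_zero, ← h i', Finset.filter_ne', add_comm]
    exact Finset.add_sum_erase _ (fun j' => del i' j' φ) (Finset.mem_univ j)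
  rw [h3, map_neg, del_del_self, neg_zero]

/-- Away from `j` the operators pass through `ins a j`, and the remaining sum vanishes because `φ`
is harmonic with no letter at `j`. The value does not depend on `j`, so differences over two
positions are harmonic. -/
theorem sum_del_ins {φ : (P → Option L) → k} (h : φ ∈ harmonic k L P) {j : P} (hj : Avoids φ j)
    (i a : L) : ∑ j', del i j' (ins a j φ) = if i = a then φ else 0 := by
  rw [mem_harmonic] at h
  rw [← Finset.add_sum_erase _ _ (Finset.mem_univ j)]
  have h1 : ∑ j' ∈ Finset.univ.erase j, del i j' (ins a j φ) = 0 := by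
    rw [Finset.sum_congr rfl fun j' hj' => del_ins_comm i a (Finset.ne_of_mem_erase hj') φ,
      ← map_sum]
    have := Finset.add_sum_erase Finset.univ (fun j' => del i j' φ) (Finset.mem_univ j)
    rw [h i, hj.del_eq_zero, zero_add] at this
    rw [this, map_zero]
  rw [h1, add_zero]
  split_ifs with hia
  · subst hia; exact del_ins_self i hj
  · exact del_ins_ne hia j φ

/-- `φ ↦ (a in position j, nothing in position l) - (nothing in position j, a in position l)`. -/
def pair (a : L) (j l : P) : ((P → Option L) → k) →ₗ[k] ((P → Option L) → k) :=
  ins a j - ins a l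

theorem pair_apply (a : L) (j l : P) (φ : (P → Option L) → k) :
    pair a j l φ = ins a j φ - ins a l φ := rfl

theorem pair_mem_harmonic {φ : (P → Option L) → k} (h : φ ∈ harmonic k L P) {j l : P}
    (hj : Avoids φ j) (hl : Avoids φ l) (a : L) : pair a j l φ ∈ harmonic k L P := by
  rw [mem_harmonic]
  intro i
  simp_rw [pair_apply, map_sub]
  rw [Finset.sum_sub_distrib, sum_del_ins h hj, sum_del_ins h hl, sub_self]

/-- An antisymmetrization over three positions. -/
def triple (i a : L) (c j l : P) (φ : (P → Option L) → k) : (P → Option L) → k :=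
  ins i c (pair a j l φ) + ins i j (pair a l c φ) + ins i l (pair a c j φ)

theorem Avoids.pair {j : P} {φ : (P → Option L) → k} (h : Avoids φ j) (a : L) {j' l : P}
    (hj : j ≠ j') (hl : j ≠ l) : Avoids (pair a j' l φ) j :=
  (h.ins a hj).sub (h.ins a hl)

/-- For the letter `i` the three summands leave `pair a j l`, `pair a l c` and `pair a c j`, which
cancel cyclically. For any other letter each summand already gives zero. -/
theorem triple_mem_harmonic {φ : (P → Option L) → k} (h : φ ∈ harmonic k L P) {c j l : P}
    (hc : Avoids φ c) (hj : Avoids φ j) (hl : Avoids φ l) (hcj : c ≠ j) (hcl : c ≠ l)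
    (hjl : j ≠ l) (i a : L) : triple i a c j l φ ∈ harmonic k L P := by
  rw [mem_harmonic]
  intro b
  simp_rw [triple, map_add]
  rw [Finset.sum_add_distrib, Finset.sum_add_distrib,
    sum_del_ins (pair_mem_harmonic h hj hl a) (hc.pair a hcj hcl),
    sum_del_ins (pair_mem_harmonic h hl hc a) (hj.pair a hjl hcj.symm),
    sum_del_ins (pair_mem_harmonic h hc hj a) (hl.pair a hcl.symm hjl.symm)]
  split_ifs
  · simp only [pair_apply]; abel
  · simp

/-- Only the first summand ever has the letter `i` in position `c`. This is how a pair arises as a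
derivative of a harmonic function. -/
theorem del_triple {φ : (P → Option L) → k} {c j l : P}
    (hc : Avoids φ c) (hcj : c ≠ j) (hcl : c ≠ l) {i a : L} (hia : i ≠ a) :
    del i c (triple i a c j l φ) = pair a j l φ := by
  rw [triple, map_add, map_add, del_ins_self i (hc.pair a hcj hcl), del_ins_comm _ _ hcj,
    del_ins_comm _ _ hcl]
  simp only [pair_apply, map_sub, del_ins_comm _ _ hcj, del_ins_comm _ _ hcl, del_ins_ne hia,
    hc.del_eq_zero, map_zero, sub_zero, add_zero]

/-- The function that is `1` on the empty word and `0` elsewhere. -/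
def emptyWord : (P → Option L) → k := Pi.single (fun _ => none) 1

theorem avoids_emptyWord (j : P) : Avoids (emptyWord : (P → Option L) → k) j := by
  intro u hu
  refine Pi.single_eq_of_ne (fun h => hu ?_) _
  rw [h]

/-- `IsProd U e φ`: the function `φ` is a product, over `e` disjoint pairs of positions with union
`U`, of antisymmetric functions on words of length two with one letter. -/
inductive IsProd : Finset P → ℕ → ((P → Option L) → k) → Prop
  | empty : IsProd ∅ 0 emptyWord
  | step {U e φ j l} (a : L) (h : IsProd U e φ) (hj : j ∉ U) (hl : l ∉ U) (hjl : j ≠ l) :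
      IsProd (insert j (insert l U)) (e + 1) (pair a j l φ)

theorem IsProd.avoids {U : Finset P} {e : ℕ} {φ : (P → Option L) → k} (h : IsProd U e φ) {j : P}
    (hj : j ∉ U) : Avoids φ j := by
  induction h with
  | empty => exact avoids_emptyWord j
  | step a _ _ _ _ ih =>
    simp only [Finset.mem_insert, not_or] at hj
    exact (ih hj.2.2).pair a hj.1 hj.2.1

theorem IsProd.mem_harmonic {U : Finset P} {e : ℕ} {φ : (P → Option L) → k}
    (h : IsProd U e φ) : φ ∈ harmonic k L P := by
  induction h with
  | empty =>
    rw [GaloisClosure.mem_harmonic]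
    exact fun i => Finset.sum_eq_zero fun j _ => (avoids_emptyWord j).del_eq_zero i
  | step a h hj hl _ ih => exact pair_mem_harmonic ih (h.avoids hj) (h.avoids hl) a

theorem IsProd.card {U : Finset P} {e : ℕ} {φ : (P → Option L) → k} (h : IsProd U e φ) :
    U.card = 2 * e := by
  induction h with
  | empty => rfl
  | step a h hj hl hjl ih =>
    rw [Finset.card_insert_of_notMem (by simp [hj, hjl]), Finset.card_insert_of_notMem hl, ih]
    ring

variable (k L) in
/-- The span of the products of `e` pairs of positions in `S`. -/
def prodSpan (S : Finset P) (e : ℕ) : Submodule k ((P → Option L) → k) :=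
  Submodule.span k {φ | ∃ U ⊆ S, IsProd U e φ}

theorem prodSpan_le_harmonic (S : Finset P) (e : ℕ) : prodSpan k L S e ≤ harmonic k L P :=
  Submodule.span_le.mpr fun _ ⟨_, _, h⟩ => h.mem_harmonic

theorem IsProd.hasWt {U : Finset P} {e : ℕ} {φ : (P → Option L) → k} (h : IsProd U e φ) :
    HasWt φ e := by
  induction h with
  | empty =>
    intro u hu
    refine Pi.single_eq_of_ne (fun h => hu ?_) _
    rw [h]
    simp [wt]
  | step a h hj hl hjl ih => exact (ih.ins a _).sub (ih.ins a _)

theorem hasWt_of_mem_prodSpan {S : Finset P} {e : ℕ} {φ : (P → Option L) → k}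
    (h : φ ∈ prodSpan k L S e) : HasWt φ e := by
  refine Submodule.span_induction (p := fun φ _ => HasWt φ e) ?_ ?_ ?_ ?_ h
  · rintro _ ⟨_, _, h⟩
    exact h.hasWt
  · exact fun _ _ => rfl
  · exact fun x y _ _ hx hy u hu => by simp [hx u hu, hy u hu]
  · exact fun c x _ hx u hu => by simp [hx u hu]

theorem avoids_of_mem_prodSpan {S : Finset P} {e : ℕ} {φ : (P → Option L) → k}
    (h : φ ∈ prodSpan k L S e) {j : P} (hj : j ∉ S) : Avoids φ j := by
  refine Submodule.span_induction (p := fun φ _ => Avoids φ j) ?_ ?_ ?_ ?_ h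
  · rintro _ ⟨U, hU, h⟩
    exact h.avoids fun h' => hj (hU h')
  · exact fun _ _ => rfl
  · exact fun x y _ _ hx hy => hx.add hy
  · exact fun c x _ hx => hx.smul c

theorem pair_mem_prodSpan {S : Finset P} {e : ℕ} {φ : (P → Option L) → k} {j l : P} (hj : j ∈ S)
    (hl : l ∈ S) (hjl : j ≠ l) (h : φ ∈ prodSpan k L ((S.erase j).erase l) e) (a : L) :
    pair a j l φ ∈ prodSpan k L S (e + 1) := by
  suffices prodSpan k L ((S.erase j).erase l) e ≤ (prodSpan k L S (e + 1)).comap (pair a j l) from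
    this h
  rw [prodSpan, Submodule.span_le]
  rintro ψ ⟨U, hU, hψ⟩
  refine Submodule.subset_span ⟨_, ?_, hψ.step a (fun h' => ?_) (fun h' => ?_) hjl⟩
  · intro m hm
    simp only [Finset.mem_insert] at hm
    rcases hm with rfl | rfl | hm
    · exact hj
    · exact hl
    · exact Finset.mem_of_mem_erase (Finset.mem_of_mem_erase (hU hm))
  · have := hU h'
    simp at this
  · have := hU h'
    simp at this

/-- Extending a combination of products by a letter in a new position, with corrections that are
supported on words with nothing in that position. -/
theorem exists_prodSpan_extension {S : Finset P} {e : ℕ} {q : P} (hq : q ∈ S)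
    (hS : 2 * (e + 1) ≤ S.card) (a : L) {ψ : (P → Option L) → k}
    (h : ψ ∈ prodSpan k L (S.erase q) e) :
    ∃ θ ∈ prodSpan k L S (e + 1), Avoids (θ - ins a q ψ) q := by
  refine Submodule.span_induction
    (p := fun ψ _ => ∃ θ ∈ prodSpan k L S (e + 1), Avoids (θ - ins a q ψ) q) ?_ ?_ ?_ ?_ h
  · rintro φ ⟨U, hU, hφ⟩
    -- The product uses `2e` positions and at least `2e + 1` remain besides `q`, so there is a free
    -- partner for `q`.
    have hc : U.card < (S.erase q).card := by
      rw [hφ.card, Finset.card_erase_of_mem hq]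
      omega
    obtain ⟨j, hjS, hjU⟩ := Finset.exists_mem_notMem_of_card_lt_card hc
    have hqU : q ∉ U := fun h => by simpa using hU h
    have hqj : q ≠ j := fun h => by simp [h] at hjS
    refine ⟨pair a q j φ, Submodule.subset_span ⟨_, ?_, hφ.step a hqU hjU hqj⟩, ?_⟩
    · intro m hm
      simp only [Finset.mem_insert] at hm
      rcases hm with rfl | rfl | hm
      · exact hq
      · exact Finset.mem_of_mem_erase hjS
      · exact Finset.mem_of_mem_erase (hU hm)
    · have h1 : pair a q j φ - ins a q φ = (-1 : k) • ins a j φ := by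
        rw [pair_apply, neg_one_smul]; abel
      rw [h1]
      exact ((hφ.avoids hqU).ins a hqj).smul _
  · exact ⟨0, Submodule.zero_mem _, fun _ _ => by simp⟩
  · rintro x y _ _ ⟨θ, h1, h2⟩ ⟨θ', h1', h2'⟩
    refine ⟨θ + θ', Submodule.add_mem _ h1 h1', ?_⟩
    rw [map_add, add_sub_add_comm]
    exact h2.add h2'
  · rintro c x _ ⟨θ, h1, h2⟩
    refine ⟨c • θ, Submodule.smul_mem _ c h1, ?_⟩
    rw [map_smul, ← smul_sub]
    exact h2.smul c

variable [Fintype L]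

theorem sum_ins_del (j : P) (φ : (P → Option L) → k) (u : P → Option L) :
    ∑ i, ins i j (del i j φ) u = if u j = none then 0 else φ u := by
  split_ifs with h
  · simp [ins_apply, h]
  · obtain ⟨a, ha⟩ := Option.ne_none_iff_exists'.mp h
    rw [Finset.sum_eq_single a]
    · rw [ins_apply, if_pos ha, del_apply, if_pos (by simp), Function.update_idem, ← ha,
        Function.update_eq_self]
    · intro b _ hb
      rw [ins_apply, if_neg]
      rw [ha]
      simpa using hb.symm
    · simp

variable [CharZero k]

/-- An Euler identity: summing `ins i j (del i j φ)` over all `i` and `j` counts letters and gives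
`(e + 1) φ`. By harmonicity the terms `ins i q (del i j φ)` sum to zero over `j`, so each insertion
can be replaced by a pair with `q`. Characteristic zero allows division by `e + 1`. -/
theorem mem_prodSpan_of_avoids {S : Finset P} {e : ℕ} {q : P} (hq : q ∈ S)
    {φ : (P → Option L) → k} (hφ : φ ∈ harmonic k L P) (hw : HasWt φ (e + 1))
    (hS : ∀ j ∉ S, Avoids φ j) (hqφ : Avoids φ q)
    (ih : ∀ j ∈ S.erase q, ∀ i, del i j φ ∈ prodSpan k L ((S.erase j).erase q) e) :
    φ ∈ prodSpan k L S (e + 1) := by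
  have key : ((e + 1 : ℕ) : k) • φ = ∑ j ∈ S.erase q, ∑ i, pair i j q (del i j φ) := by
    have h0 : ∀ j ∉ S.erase q, Avoids φ j := by
      intro j hj
      by_cases h : j = q
      · rwa [h]
      · exact hS j fun h' => hj (Finset.mem_erase.mpr ⟨h, h'⟩)
    have h1 : ∑ j ∈ S.erase q, ∑ i, ins i q (del i j φ) = 0 := by
      rw [Finset.sum_comm]
      refine Finset.sum_eq_zero fun i _ => ?_
      rw [← map_sum, Finset.sum_subset (Finset.subset_univ _) fun j _ hj =>
        (h0 j hj).del_eq_zero i, mem_harmonic.mp hφ i, map_zero]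
    simp only [pair_apply, Finset.sum_sub_distrib]
    rw [h1, sub_zero]
    ext u
    simp only [Finset.sum_apply, sum_ins_del, Pi.smul_apply, smul_eq_mul]
    rw [Finset.sum_subset (Finset.subset_univ _) fun j _ hj => by
      split_ifs with h
      · rfl
      · exact h0 j hj u h]
    by_cases hu : wt u = e + 1
    · rw [← hu, wt, Finset.sum_ite, Finset.sum_const_zero, zero_add, Finset.sum_const,
        nsmul_eq_mul]
    · simp [hw u hu]
  have hne : ((e + 1 : ℕ) : k) ≠ 0 := Nat.cast_ne_zero.mpr (Nat.succ_ne_zero e)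
  rw [← Submodule.smul_mem_iff _ hne, key]
  refine Submodule.sum_mem _ fun j hj => Submodule.sum_mem _ fun i _ => ?_
  exact pair_mem_prodSpan (Finset.mem_of_mem_erase hj) hq (Finset.ne_of_mem_erase hj)
    (ih j hj i) i

/-- Harmonic functions with few letters are combinations of products. -/
theorem harmonic_mem_prodSpan (e : ℕ) : ∀ (S : Finset P), 2 * e ≤ S.card →
    ∀ φ : (P → Option L) → k, φ ∈ harmonic k L P → HasWt φ e → (∀ j ∉ S, Avoids φ j) →
    φ ∈ prodSpan k L S e := by
  induction e with
  | zero =>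
    intro S _ φ _ hw _
    have h : φ = φ (fun _ => none) • emptyWord := by
      ext u
      by_cases hu : u = fun _ => none
      · subst hu; simp [emptyWord]
      · rw [hw u, Pi.smul_apply, emptyWord, Pi.single_eq_of_ne hu, smul_zero]
        contrapose! hu
        rw [wt, Finset.card_eq_zero, Finset.filter_eq_empty_iff] at hu
        ext1 j
        simpa using hu (Finset.mem_univ j)
    rw [h]
    exact Submodule.smul_mem _ _ (Submodule.subset_span ⟨∅, Finset.empty_subset _, .empty⟩)
  | succ e ih =>
    intro S hS φ hφ hw hav
    obtain ⟨q, hq⟩ : S.Nonempty := Finset.card_pos.mp (by omega)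
    have hdel : ∀ i, del i q φ ∈ prodSpan k L (S.erase q) e := by
      intro i
      refine ih _ (by rw [Finset.card_erase_of_mem hq]; omega) _ (del_mem_harmonic hφ i q)
        (hw.del i q) fun j hj => ?_
      by_cases h : j = q
      · rw [h]; exact avoids_del i q φ
      · exact (hav j fun h' => hj (Finset.mem_erase.mpr ⟨h, h'⟩)).del i q
    -- Each `θ i` agrees with `φ` on the words that have the letter `i` at `q`. Subtracting them all
    -- removes every letter at `q` and leaves a case for `mem_prodSpan_of_avoids`.
    choose θ hθ hθq using fun i => exists_prodSpan_extension hq hS i (hdel i)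
    have hsum : ∑ i, θ i ∈ prodSpan k L S (e + 1) := Submodule.sum_mem _ fun i _ => hθ i
    set φ' := φ - ∑ i, θ i with hφ'
    have hq' : Avoids φ' q := by
      intro u hu
      have h1 := sum_ins_del q φ u
      rw [if_neg hu] at h1
      rw [hφ', Pi.sub_apply, ← h1, Finset.sum_apply, ← Finset.sum_sub_distrib]
      refine Finset.sum_eq_zero fun i _ => ?_
      have := hθq i u hu
      rw [Pi.sub_apply] at this
      rw [← neg_sub, this, neg_zero]
    have hφ'h : φ' ∈ harmonic k L P :=
      Submodule.sub_mem _ hφ (prodSpan_le_harmonic _ _ hsum)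
    have hφ'w : HasWt φ' (e + 1) := hw.sub (hasWt_of_mem_prodSpan hsum)
    have hφ'S : ∀ j ∉ S, Avoids φ' j := fun j hj =>
      (hav j hj).sub (avoids_of_mem_prodSpan hsum hj)
    have : φ' ∈ prodSpan k L S (e + 1) := by
      -- The derivatives of `φ'` avoid both `q` and `j`, so two positions are lost while the weight
      -- drops by one; the bound `2e ≤ |S|` survives the induction.
      refine mem_prodSpan_of_avoids hq hφ'h hφ'w hφ'S hq' fun j hj i => ?_
      refine ih _ ?_ _ (del_mem_harmonic hφ'h i j) (hφ'w.del i j) fun m hm => ?_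
      · have := Finset.mem_of_mem_erase hj
        rw [Finset.card_erase_of_mem, Finset.card_erase_of_mem this]
        · omega
        · exact Finset.mem_erase.mpr ⟨(Finset.ne_of_mem_erase hj).symm, hq⟩
      · by_cases hmq : m = q
        · rw [hmq]; exact hq'.del i j
        · by_cases hmj : m = j
          · rw [hmj]; exact avoids_del i j φ'
          · exact (hφ'S m fun h => hm (by simp [hmq, hmj, h])).del i j
    rw [← sub_add_cancel φ (∑ i, θ i)]
    exact Submodule.add_mem _ this hsum

end Words

/-! ### Linear presentation of `G(A_n)` and its dual as harmonic functions. -/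

section Presentation

open Polynomial

/-- A product of linear factors whose roots are square-zero with sum zero is a power of `X`. -/
theorem prod_X_sub_C_eq_X_pow {k R σ : Type*} [Field k] [CharZero k] [CommRing R] [Algebra k R]
    [Fintype σ] (v : σ → R) (hsq : ∀ i, v i * v i = 0) (hsum : ∑ i, v i = 0) :
    ∏ i, (X - C (v i)) = X ^ Fintype.card σ := by
  have hps : ∀ m, 0 < m → MvPolynomial.aeval v (MvPolynomial.psum σ k m) = 0 := by
    intro m hm
    rw [MvPolynomial.psum, map_sum]
    simp only [map_pow, MvPolynomial.aeval_X]
    obtain ⟨m, rfl⟩ := Nat.exists_eq_succ_of_ne_zero hm.ne'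
    rcases m with _ | m
    · simpa using hsum
    · exact Finset.sum_eq_zero fun i _ => by rw [pow_succ, pow_succ, mul_assoc, hsq, mul_zero]
  -- In Newton's identity for `m e_m` every term contains a power sum of positive degree; `m` is
  -- invertible in characteristic zero.
  have hes : ∀ m, 0 < m → MvPolynomial.aeval v (MvPolynomial.esymm σ k m) = 0 := by
    intro m hm
    have h := congrArg (MvPolynomial.aeval v) (MvPolynomial.mul_esymm_eq_sum σ k m)
    rw [map_mul, map_mul, map_sum, Finset.sum_eq_zero, mul_zero, map_natCast] at h
    · have hu : IsUnit (m : R) := by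
        rw [← map_natCast (algebraMap k R)]
        exact (IsUnit.mk0 _ (Nat.cast_ne_zero.mpr hm.ne')).map _
      exact hu.mul_right_eq_zero.mp h
    · intro a ha
      obtain ⟨ha, hlt⟩ := Finset.mem_filter.mp ha
      have ha := Finset.HasAntidiagonal.mem_antidiagonal.mp ha
      rw [map_mul, hps a.2 (by omega), mul_zero]
  have h1 : ∏ i, (X - C (v i)) = ((Finset.univ.val.map v).map fun t => X - C t).prod := by
    rw [Multiset.map_map]; rfl
  rw [h1, Multiset.prod_X_sub_X_eq_sum_esymm, Multiset.card_map, Finset.card_val,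
    Finset.card_univ, Finset.sum_range_succ', Finset.sum_eq_zero]
  · simp [Multiset.esymm]
  · intro j _
    rw [← MvPolynomial.aeval_esymm_eq_multiset_esymm σ k, hes _ j.succ_pos]
    simp

/-- Translating the variable by `c` turns the product over the roots `v i`, which is `X ^ n`, into
`(X - c) ^ n`. The same polynomial is the characteristic polynomial in
`charpoly_mulLeft_algebraMap_add`. -/
theorem aeval_esymm_algebraMap_add {k R : Type*} [Field k] [CharZero k] [CommRing R]
    [Algebra k R] {n : ℕ} (v : Fin n → R) (hsq : ∀ i, v i * v i = 0) (hsum : ∑ i, v i = 0)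
    (c : k) {m : ℕ} (hm : m ≤ n) :
    MvPolynomial.aeval (fun i => algebraMap k R c + v i) (MvPolynomial.esymm (Fin n) k m) =
      algebraMap k R ((-1) ^ m * ((X - C c) ^ n).coeff (n - m)) := by
  have hprod : ∏ i, (X - C (algebraMap k R c + v i)) = (X - C (algebraMap k R c)) ^ n := by
    have := congrArg (fun p => p.comp (X - C (algebraMap k R c)))
      (prod_X_sub_C_eq_X_pow (k := k) v hsq hsum)
    rw [Fintype.card_fin, X_pow_comp] at this
    rw [← this, prod_comp]
    refine Finset.prod_congr rfl fun j _ => ?_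
    rw [sub_comp, X_comp, C_comp, C_add]
    ring
  have h1 : ∏ i, (X - C (algebraMap k R c + v i)) =
      ((Finset.univ.val.map fun i => algebraMap k R c + v i).map fun t => X - C t).prod := by
    rw [Multiset.map_map]; rfl
  have h2 := Multiset.prod_X_sub_C_coeff
    (Finset.univ.val.map fun i => algebraMap k R c + v i) (k := n - m) (by simp)
  rw [← h1, hprod, Multiset.card_map, Finset.card_val, Finset.card_univ, Fintype.card_fin,
    Nat.sub_sub_self hm, ← MvPolynomial.aeval_esymm_eq_multiset_esymm (Fin n) k] at h2
  have h4 : algebraMap k R (((X - C c) ^ n).coeff (n - m)) =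
      ((X - C (algebraMap k R c)) ^ n).coeff (n - m) := by
    rw [← coeff_map, Polynomial.map_pow, Polynomial.map_sub, map_X, map_C]
  rw [map_mul, h4, h2, map_pow, map_neg, map_one, ← mul_assoc, ← mul_pow, neg_one_mul, neg_neg,
    one_pow, one_mul]

theorem charpoly_mulLeft_algebraMap_add {k A : Type*} [Field k] [CommRing A] [Algebra k A]
    [Module.Finite k A] (c : k) {v : A} (hv : v * v = 0) :
    (LinearMap.mulLeft k (algebraMap k A c + v)).charpoly =
      (X - C c) ^ Module.finrank k A := by
  have h1 : LinearMap.mulLeft k (algebraMap k _ c + v) =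
      LinearMap.mulLeft k v - (-c) • (1 : Module.End k A) := by
    ext y
    simp [add_mul, Algebra.smul_def, add_comm]
  have h2 : IsNilpotent (LinearMap.mulLeft k v) := by
    refine ⟨2, ?_⟩
    rw [LinearMap.pow_mulLeft, pow_two, hv, LinearMap.mulLeft_zero_eq_zero]
  rw [h1, LinearMap.charpoly_sub_smul, h2.charpoly_eq_X_pow_finrank]
  simp [sub_eq_add_neg]

variable (k : Type*) [Field k] (n : ℕ)

/-- The basis `1, x₁, …, x_{n-1}` of `A_n`, as a family. -/
def letter : Option (Fin (n - 1)) → AlgA k n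
  | none => 1
  | some i => varA k n i

/-- The identification of `A_n` with a trivial square-zero extension. -/
def toTrivSqZeroExt : AlgA k n →ₐ[k] TrivSqZeroExt k (Fin (n - 1) → k) :=
  Ideal.Quotient.liftₐ _ (MvPolynomial.aeval fun i => TrivSqZeroExt.inr (Pi.single i 1)) (by
    intro a ha
    suffices MvPolynomial.idealOfVars (Fin (n - 1)) k ^ 2 ≤
        RingHom.ker (MvPolynomial.aeval fun i =>
          (TrivSqZeroExt.inr (Pi.single i 1) : TrivSqZeroExt k (Fin (n - 1) → k))) from this ha
    rw [pow_two, MvPolynomial.idealOfVars, Ideal.span_mul_span', Ideal.span_le]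
    rintro _ ⟨_, ⟨i, rfl⟩, _, ⟨j, rfl⟩, rfl⟩
    simp [RingHom.mem_ker])

theorem toTrivSqZeroExt_varA (i : Fin (n - 1)) :
    toTrivSqZeroExt k n (varA k n i) = TrivSqZeroExt.inr (Pi.single i 1) := by
  change Ideal.Quotient.liftₐ _ _ _ (Ideal.Quotient.mk _ _) = _
  erw [Ideal.Quotient.lift_mk]
  simp

theorem linearIndependent_letter : LinearIndependent k (letter k n) := by
  rw [Fintype.linearIndependent_iff]
  intro g hg
  rw [Fintype.sum_option] at hg
  have h := congrArg (toTrivSqZeroExt k n) hg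
  simp only [letter, map_add, map_sum, map_smul, map_one, toTrivSqZeroExt_varA, map_zero] at h
  have h1 := congrArg TrivSqZeroExt.fst h
  have h2 := congrArg TrivSqZeroExt.snd h
  simp [← TrivSqZeroExt.inr_smul, ← TrivSqZeroExt.inr_sum] at h1 h2
  rintro (_ | i)
  · exact h1
  · have := congrFun h2 i
    simpa [Finset.sum_apply, Pi.single_apply] using this

theorem span_letter : ⊤ ≤ Submodule.span k (Set.range (letter k n)) := by
  rintro y -
  obtain ⟨p, rfl⟩ := Ideal.Quotient.mk_surjective y
  induction p using MvPolynomial.induction_on with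
  | C a =>
    have h : Ideal.Quotient.mk ((MvPolynomial.idealOfVars (Fin (n - 1)) k) ^ 2)
        (MvPolynomial.C a) = a • letter k n none := by
      rw [Algebra.smul_def, letter, mul_one]
      rfl
    rw [h]
    exact Submodule.smul_mem _ _ (Submodule.subset_span ⟨_, rfl⟩)
  | add p q hp hq => rw [map_add]; exact Submodule.add_mem _ hp hq
  | mul_X p i hp =>
    rw [map_mul]
    change _ * varA k n i ∈ _
    refine Submodule.span_induction (p := fun y _ => y * varA k n i ∈ _) ?_ ?_ ?_ ?_ hp
    · rintro _ ⟨_ | j, rfl⟩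
      · rw [letter, one_mul]
        exact Submodule.subset_span ⟨some i, rfl⟩
      · rw [letter, varA_mul_varA]
        exact Submodule.zero_mem _
    · rw [zero_mul]
      exact Submodule.zero_mem _
    · intro y z _ _ hy hz
      rw [add_mul]
      exact Submodule.add_mem _ hy hz
    · intro c y _ hy
      rw [smul_mul_assoc]
      exact Submodule.smul_mem _ _ hy

/-- The basis `1, x₁, …, x_{n-1}` of `A_n`. -/
def basisA : Module.Basis (Option (Fin (n - 1))) k (AlgA k n) :=
  Module.Basis.mk (linearIndependent_letter k n) (span_letter k n)

theorem basisA_apply (o : Option (Fin (n - 1))) : basisA k n o = letter k n o :=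
  Module.Basis.mk_apply _ _ o

variable {n}

theorem finrank_algA (hn : 1 ≤ n) : Module.finrank k (AlgA k n) = n := by
  rw [Module.finrank_eq_card_basis (basisA k n), Fintype.card_option, Fintype.card_fin]
  omega

variable {k} in
theorem exists_eq_algebraMap_add (a : AlgA k n) : ∃ (c : k) (g : Fin (n - 1) → k),
    a = algebraMap k _ c + ∑ i, g i • varA k n i := by
  have h := (basisA k n).sum_repr a
  rw [Fintype.sum_option] at h
  refine ⟨(basisA k n).repr a none, fun i => (basisA k n).repr a (some i), ?_⟩
  simp_rw [basisA_apply] at h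
  rw [Algebra.algebraMap_eq_smul_one]
  exact h.symm

variable {k} in
theorem sum_varA_mul_self (g : Fin (n - 1) → k) :
    (∑ i, g i • varA k n i) * (∑ i, g i • varA k n i) = 0 := by
  rw [Finset.sum_mul_sum]
  exact Finset.sum_eq_zero fun i _ => Finset.sum_eq_zero fun j _ => by
    rw [smul_mul_smul_comm, varA_mul_varA, smul_zero]

theorem esymm_one_eq {R : Type*} [CommRing R] [Algebra k R] (v : Fin n → R) :
    MvPolynomial.aeval v (MvPolynomial.esymm (Fin n) k 1) = ∑ i, v i := by
  rw [MvPolynomial.esymm_one, map_sum]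
  simp

theorem conj_add {i : Fin n} (a b : AlgA k n) : conj k i (a + b) = conj k i a + conj k i b :=
  map_add (PiTensorProduct.singleAlgHom (R := k) (A := fun _ : Fin n => AlgA k n) i) a b

theorem conj_zero (i : Fin n) : conj k i (0 : AlgA k n) = 0 :=
  map_zero (PiTensorProduct.singleAlgHom (R := k) (A := fun _ : Fin n => AlgA k n) i)

theorem conj_mul {i : Fin n} (a b : AlgA k n) : conj k i (a * b) = conj k i a * conj k i b :=
  map_mul (PiTensorProduct.singleAlgHom (R := k) (A := fun _ : Fin n => AlgA k n) i) a b

theorem conj_algebraMap (i : Fin n) (c : k) :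
    conj k i (algebraMap k (AlgA k n) c) = algebraMap k _ c :=
  AlgHom.commutes (PiTensorProduct.singleAlgHom (R := k) (A := fun _ : Fin n => AlgA k n) i) c

theorem conj_sum_smul (i : Fin n) (g : Fin (n - 1) → k) :
    conj k i (∑ l, g l • varA k n l) = ∑ l, g l • conj k i (varA k n l) := by
  have := map_sum (PiTensorProduct.singleAlgHom (R := k) (A := fun _ : Fin n => AlgA k n) i)
    (fun l => g l • varA k n l) Finset.univ
  simp only [map_smul] at this
  exact this

/-- In characteristic zero `G(A_n)` is defined by the linear relations `∑ⱼ x_{i,j} = 0`. -/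
theorem relIdeal_eq [CharZero k] (hn : 1 ≤ n) : relIdeal k (AlgA k n) n =
    Ideal.span (Set.range fun i => ∑ j, conj k j (varA k n i)) := by
  apply le_antisymm
  · rw [relIdeal, Ideal.span_le]
    rintro _ ⟨a, m, hm1, hmn, rfl⟩
    set J := Ideal.span (Set.range fun i => ∑ j, conj k (n := n) j (varA k n i)) with hJ
    obtain ⟨c, g, rfl⟩ := exists_eq_algebraMap_add a
    set v := ∑ i, g i • varA k n i with hv
    have hvv : v * v = 0 := sum_varA_mul_self g
    let π := Ideal.Quotient.mkₐ k J
    have hsum : ∑ j, π (conj k j v) = 0 := by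
      rw [← map_sum]
      change Ideal.Quotient.mk J _ = 0
      rw [Ideal.Quotient.eq_zero_iff_mem]
      simp_rw [hv, conj_sum_smul]
      rw [Finset.sum_comm]
      simp_rw [← Finset.smul_sum]
      exact Submodule.sum_mem _ fun i _ =>
        Submodule.smul_of_tower_mem _ _ (Ideal.subset_span ⟨i, rfl⟩)
    have hsq : ∀ j, π (conj k j v) * π (conj k j v) = 0 := fun j => by
      rw [← map_mul, ← conj_mul, hvv, conj_zero, map_zero]
    have h1 := aeval_esymm_algebraMap_add (k := k) (fun j => π (conj k (n := n) j v)) hsq hsum c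
      hmn
    have h2 : π (conjEsymm k n m (algebraMap k _ c + v)) = MvPolynomial.aeval
        (fun j => algebraMap k _ c + π (conj k (n := n) j v))
        (MvPolynomial.esymm (Fin n) k m) := by
      rw [conjEsymm, ← AlgHom.comp_apply, MvPolynomial.comp_aeval]
      congr 2
      ext1 j
      rw [conj_add, conj_algebraMap, map_add, AlgHom.commutes]
    have h3 : π (algebraMap k _ (charCoeff k n m (algebraMap k _ c + v)) -
        conjEsymm k n m (algebraMap k _ c + v)) = 0 := by
      rw [map_sub, AlgHom.commutes, charCoeff, charpoly_mulLeft_algebraMap_add c hvv,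
        finrank_algA k hn, h2, h1, sub_self]
    exact Ideal.Quotient.eq_zero_iff_mem.mp h3
  · rw [Ideal.span_le]
    rintro _ ⟨i, rfl⟩
    -- The linear relation is the original one for `a = x_i` and `j = 1`, since multiplication by
    -- `x_i` is nilpotent and has trace zero.
    have h1 : charCoeff k n 1 (varA k n i) = 0 := by
      have := charpoly_mulLeft_algebraMap_add (0 : k) (varA_mul_varA k n i i)
      rw [map_zero, zero_add, map_zero, sub_zero, finrank_algA k hn] at this
      rw [charCoeff, this, coeff_X_pow, if_neg (by omega), mul_zero]
    have h2 : (∑ j, conj k j (varA k n i)) = conjEsymm k n 1 (varA k n i) := by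
      rw [conjEsymm, esymm_one_eq]
    have h3 : algebraMap k (TensorPow k (AlgA k n) n) (charCoeff k n 1 (varA k n i)) -
        conjEsymm k n 1 (varA k n i) ∈ relIdeal k (AlgA k n) n :=
      Ideal.subset_span ⟨_, 1, le_rfl, hn, rfl⟩
    rw [h1, map_zero, zero_sub, ← h2, neg_mem_iff] at h3
    exact h3

/-- The pure tensor with the letters of the word `u` as its factors. -/
def tensorWord (u : Fin n → Option (Fin (n - 1))) : TensorPow k (AlgA k n) n :=
  PiTensorProduct.tprod k fun j => letter k n (u j)

theorem conj_mul_tensorWord (i : Fin (n - 1)) (j : Fin n) (u : Fin n → Option (Fin (n - 1))) :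
    conj k j (varA k n i) * tensorWord k u =
      if u j = none then tensorWord k (Function.update u j (some i)) else 0 := by
  rw [conj, PiTensorProduct.singleAlgHom_apply, tensorWord, PiTensorProduct.tprod_mul_tprod]
  split_ifs with h
  · rw [tensorWord]
    congr 1
    ext1 l
    by_cases hl : l = j
    · subst hl
      simp [h, letter]
    · simp [hl]
  · apply MultilinearMap.map_coord_zero _ j
    obtain ⟨a, ha⟩ := Option.ne_none_iff_exists'.mp h
    simp [ha, letter, varA_mul_varA]

/-- The monomial in the `x_{i,j}` given by a word. -/
def word (u : Fin n → Option (Fin (n - 1))) : GA k n :=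
  Ideal.Quotient.mk _ (tensorWord k u)

/-- The transpose of this rule is `del i j`, which links linear forms on `G(A_n)` to functions on
words. -/
theorem x_mul_word (i : Fin (n - 1)) (j : Fin n) (u : Fin n → Option (Fin (n - 1))) :
    x k n i j * word k u = if u j = none then word k (Function.update u j (some i)) else 0 := by
  rw [x, word, ← map_mul, conj_mul_tensorWord]
  split_ifs
  · rfl
  · rw [map_zero]

theorem word_none : word k (fun _ : Fin n => none) = 1 := by
  rw [word, tensorWord, ← map_one (Ideal.Quotient.mk (relIdeal k (AlgA k n) n))]
  rfl

theorem x_mul_x (i i' : Fin (n - 1)) (j : Fin n) : x k n i j * x k n i' j = 0 := by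
  rw [x, x, ← map_mul, ← conj_mul, varA_mul_varA, conj_zero, map_zero]

theorem sum_x [CharZero k] (hn : 1 ≤ n) (i : Fin (n - 1)) : ∑ j, x k n i j = 0 := by
  simp_rw [x]
  rw [← map_sum, Ideal.Quotient.eq_zero_iff_mem, relIdeal_eq k hn]
  exact Ideal.subset_span ⟨i, rfl⟩

/-- A linear form on `G(A_n)` gives a harmonic function on words. -/
theorem functional_mem_harmonic [CharZero k] (hn : 1 ≤ n) (f : GA k n →ₗ[k] k) :
    (fun u => f (word k u)) ∈ harmonic k (Fin (n - 1)) (Fin n) := by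
  rw [mem_harmonic]
  intro i
  ext u
  have h : f ((∑ j, x k n i j) * word k u) = 0 := by rw [sum_x k hn, zero_mul, map_zero]
  rw [Finset.sum_mul, map_sum] at h
  rw [Finset.sum_apply, Pi.zero_apply, ← h]
  refine Finset.sum_congr rfl fun j _ => ?_
  rw [x_mul_word, del_apply]
  split_ifs <;> simp

/-- The basis of the tensor power consisting of the words. -/
def tensorBasis : Module.Basis (Fin n → Option (Fin (n - 1))) k (TensorPow k (AlgA k n) n) :=
  Basis.piTensorProduct fun _ => basisA k n

theorem tensorBasis_apply (u : Fin n → Option (Fin (n - 1))) :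
    tensorBasis k u = tensorWord k u := by
  rw [tensorBasis, Basis.piTensorProduct_apply]
  simp_rw [basisA_apply]
  rfl

/-- A harmonic function on words gives a linear form on `G(A_n)`. -/
theorem exists_functional [CharZero k] (hn : 1 ≤ n)
    {φ : (Fin n → Option (Fin (n - 1))) → k} (hφ : φ ∈ harmonic k (Fin (n - 1)) (Fin n)) :
    ∃ f : GA k n →ₗ[k] k, ∀ u, f (word k u) = φ u := by
  let F : TensorPow k (AlgA k n) n →ₗ[k] k := (tensorBasis k).constr k φ
  have hF : ∀ u, F (tensorWord k u) = φ u := fun u => by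
    rw [← tensorBasis_apply]; exact (tensorBasis k).constr_basis k φ u
  have hF0 : ∀ z ∈ relIdeal k (AlgA k n) n, F z = 0 := by
    intro z hz
    rw [relIdeal_eq k hn] at hz
    -- Quantifying over all multiples `t * z` makes the predicate stable under the ideal operations;
    -- `t = 1` is used at the end.
    refine Submodule.span_induction (p := fun z _ => ∀ t, F (t * z) = 0) ?_ ?_ ?_ ?_ hz 1 |>
      fun h => by simpa using h
    · rintro _ ⟨i, rfl⟩ t
      suffices F ∘ₗ LinearMap.mulRight k (∑ j, conj k j (varA k n i)) = 0 from
        LinearMap.congr_fun this t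
      refine (tensorBasis k).ext fun u => ?_
      rw [LinearMap.comp_apply, LinearMap.mulRight_apply, tensorBasis_apply, mul_comm,
        Finset.sum_mul, map_sum, LinearMap.zero_apply]
      have := congrFun (mem_harmonic.mp hφ i) u
      rw [Finset.sum_apply, Pi.zero_apply] at this
      rw [← this]
      refine Finset.sum_congr rfl fun j _ => ?_
      rw [conj_mul_tensorWord, del_apply]
      split_ifs <;> simp [hF]
    · simp
    · intro y z _ _ hy hz t
      rw [mul_add, map_add, hy, hz, add_zero]
    · intro c z _ hz t
      rw [smul_eq_mul, ← mul_assoc, hz]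
  refine ⟨((relIdeal k (AlgA k n) n).restrictScalars k).liftQ F hF0 ∘ₗ
    (Submodule.Quotient.restrictScalarsEquiv k (relIdeal k (AlgA k n) n)).symm.toLinearMap,
    fun u => ?_⟩
  rw [← hF]
  rfl

variable (n) in
/-- The span of the words with `e` letters. -/
def wordSpan (e : ℕ) : Submodule k (GA k n) :=
  Submodule.span k {z | ∃ u : Fin n → Option (Fin (n - 1)), wt u = e ∧ word k u = z}

theorem x_mul_mem_wordSpan {e : ℕ} {s : GA k n} (hs : s ∈ wordSpan k n e) (i : Fin (n - 1))
    (j : Fin n) : x k n i j * s ∈ wordSpan k n (e + 1) := by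
  refine Submodule.span_induction (p := fun s _ => x k n i j * s ∈ wordSpan k n (e + 1))
    ?_ ?_ ?_ ?_ hs
  · rintro _ ⟨u, hu, rfl⟩
    rw [x_mul_word]
    split_ifs with h
    · exact Submodule.subset_span ⟨_, by rw [wt_update_some h, hu], rfl⟩
    · exact Submodule.zero_mem _
  · rw [mul_zero]; exact Submodule.zero_mem _
  · intro y z _ _ hy hz
    rw [mul_add]; exact Submodule.add_mem _ hy hz
  · intro c y _ hy
    rw [mul_smul_comm]; exact Submodule.smul_mem _ _ hy

theorem pres_monomial_mem (e : ℕ) : ∀ (d : (Fin (n - 1) × Fin n) →₀ ℕ) (c : k), d.degree = e →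
    pres k n (MvPolynomial.monomial d c) ∈ wordSpan k n e := by
  induction e with
  | zero =>
    intro d c hd
    rw [Finsupp.degree_eq_zero_iff] at hd
    have : pres k n (MvPolynomial.monomial 0 c) = c • word k fun _ => none := by
      rw [← MvPolynomial.C_apply, word_none, ← Algebra.algebraMap_eq_smul_one]
      exact AlgHom.commutes (pres k n) c
    rw [hd, this]
    exact Submodule.smul_mem _ _ (Submodule.subset_span ⟨_, by simp [wt], rfl⟩)
  | succ e ih =>
    intro d c hd
    have hne : d ≠ 0 := by
      rintro rfl
      simp at hd
    obtain ⟨p, hp⟩ := Finsupp.ne_iff.mp hne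
    have hle : Finsupp.single p 1 ≤ d := by
      rw [Finsupp.single_le_iff]
      exact Nat.one_le_iff_ne_zero.mpr hp
    obtain ⟨d', rfl⟩ := exists_add_of_le hle
    rw [map_add, Finsupp.degree_single, add_comm 1, Nat.succ_inj] at hd
    have h1 : MvPolynomial.monomial (Finsupp.single p 1 + d') c =
        MvPolynomial.X p * MvPolynomial.monomial d' c := by
      rw [MvPolynomial.X, MvPolynomial.monomial_mul, one_mul]
    have h2 : pres k n (MvPolynomial.X p) = x k n p.1 p.2 := MvPolynomial.aeval_X _ _
    rw [h1, map_mul, h2]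
    exact x_mul_mem_wordSpan k (ih d' c hd) p.1 p.2

theorem degPart_le_wordSpan (e : ℕ) : degPart k n e ≤ wordSpan k n e := by
  rintro _ ⟨p, hp, rfl⟩
  change pres k n p ∈ _
  rw [p.as_sum, map_sum]
  refine Submodule.sum_mem _ fun d hd => pres_monomial_mem k e d _ ?_
  by_contra h
  exact MvPolynomial.mem_support_iff.mp hd
    (((MvPolynomial.mem_homogeneousSubmodule e p).mp hp).coeff_eq_zero h)

theorem multiPart_le_degPart (d : Fin (n - 1) → ℕ) : multiPart k n d ≤ degPart k n (∑ i, d i) := by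
  refine Submodule.map_mono fun p hp => ?_
  rw [MvPolynomial.mem_weightedHomogeneousSubmodule] at hp
  rw [MvPolynomial.mem_homogeneousSubmodule]
  intro e he
  have h := hp he
  rw [← h, Finsupp.weight_apply, Finsupp.weight_apply]
  simp only [Finsupp.sum, Finset.sum_apply, Pi.smul_apply, smul_eq_mul, Pi.one_apply, mul_one]
  rw [Finset.sum_comm]
  refine Finset.sum_congr rfl fun q _ => ?_
  simp [Pi.single_apply]

theorem mem_socle_iff {s : GA k n} : s ∈ socle k n ↔ ∀ i j, x k n i j * s = 0 := by
  rw [socle, Submodule.mem_annihilator]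
  constructor
  · intro h i j
    rw [mul_comm]
    exact h _ (Ideal.subset_span ⟨(i, j), rfl⟩)
  · intro h t ht
    refine Submodule.span_induction (p := fun t _ => s • t = 0) ?_ ?_ ?_ ?_ ht
    · rintro _ ⟨p, rfl⟩
      rw [smul_eq_mul, mul_comm]
      exact h _ _
    · simp
    · intro y z _ _ hy hz
      rw [smul_add, hy, hz, add_zero]
    · intro c z _ hz
      rw [smul_comm, hz, smul_zero]

end Presentation

/-! ### Vanishing of the socle below degree `n / 2`. -/

section LowDegree

variable {k : Type*} [Field k] {n : ℕ}

/-- The last pair of the product is enlarged to a triple through the free position `c`, with a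
letter `i` different from that of the pair. The empty product has no pair, and there a single pair
through `c` suffices. -/
theorem IsProd.exists_harmonic_del {L : Type*} [DecidableEq L] [Nontrivial L]
    {U : Finset (Fin n)} {e : ℕ} {ψ : (Fin n → Option L) → k} (h : IsProd U e ψ) (hn : 2 ≤ n)
    {c : Fin n} (hc : c ∉ U) : ∃ i, ∃ t ∈ harmonic k L (Fin n), del i c t = ψ := by
  cases h with
  | empty =>
    obtain ⟨i, -⟩ := exists_pair_ne L
    have : Nontrivial (Fin n) := Fin.nontrivial_iff_two_le.mpr hn
    obtain ⟨l, hl⟩ := exists_ne c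
    refine ⟨i, pair i c l emptyWord,
      pair_mem_harmonic IsProd.empty.mem_harmonic (avoids_emptyWord _) (avoids_emptyWord _) i, ?_⟩
    rw [pair_apply, map_sub, del_ins_self i (avoids_emptyWord c), del_ins_comm _ _ hl.symm,
      (avoids_emptyWord c).del_eq_zero, map_zero, sub_zero]
  | @step U e φ j l a h hj hl hjl =>
    simp only [Finset.mem_insert, not_or] at hc
    obtain ⟨hcj, hcl, hc⟩ := hc
    obtain ⟨i, hi⟩ := exists_ne a
    exact ⟨i, triple i a c j l φ, triple_mem_harmonic h.mem_harmonic (h.avoids hc) (h.avoids hj)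
      (h.avoids hl) hcj hcl hjl i a, del_triple (h.avoids hc) hcj hcl hi⟩

/-- Each `del i j` lowers the weight by exactly one, so the harmonic condition separates by weight.
-/
theorem truncate_mem_harmonic {L P : Type*} [DecidableEq L] [DecidableEq P] [Fintype P]
    {φ : (P → Option L) → k} (h : φ ∈ harmonic k L P) (e : ℕ) :
    (fun u => if wt u = e then φ u else 0) ∈ harmonic k L P := by
  rw [mem_harmonic] at h ⊢
  intro i
  ext u
  have hu := congrFun (h i) u
  rw [Finset.sum_apply] at hu ⊢
  by_cases hw : wt u + 1 = e
  · rw [← hu]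
    refine Finset.sum_congr rfl fun j _ => ?_
    rw [del_apply, del_apply]
    split_ifs with h1 h2
    · rfl
    · exact absurd (by rw [wt_update_some h1, hw]) h2
    · rfl
  · refine Finset.sum_eq_zero fun j _ => ?_
    rw [del_apply]
    split_ifs with h1 h2
    · exact absurd (by rw [← h2, wt_update_some h1]) hw
    · rfl
    · rfl

/-- The socle of `G(A_n)` vanishes in degrees below `n / 2`. -/
theorem eq_zero_of_mem_socle [CharZero k] (hn : 3 ≤ n) {e : ℕ} (he : 2 * e < n) {s : GA k n}
    (hs : s ∈ wordSpan k n e) (hsoc : s ∈ socle k n) : s = 0 := by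
  have hL : Nontrivial (Fin (n - 1)) := Fin.nontrivial_iff_two_le.mpr (by omega)
  rw [← Module.forall_dual_apply_eq_zero_iff k]
  intro f
  -- The functions on words induced by linear forms that vanish at `s`.
  let N : Submodule k ((Fin n → Option (Fin (n - 1))) → k) :=
    { carrier := {φ | ∃ g : GA k n →ₗ[k] k, (∀ u, g (word k u) = φ u) ∧ g s = 0}
      zero_mem' := ⟨0, fun _ => rfl, rfl⟩
      add_mem' := by
        rintro φ ψ ⟨g, h1, h2⟩ ⟨g', h1', h2'⟩
        exact ⟨g + g', fun u => by simp [h1, h1'], by simp [h2, h2']⟩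
      smul_mem' := by
        rintro c φ ⟨g, h1, h2⟩
        exact ⟨c • g, fun u => by simp [h1], by simp [h2]⟩ }
  have hN : prodSpan k (Fin (n - 1)) Finset.univ e ≤ N := by
    rw [prodSpan, Submodule.span_le]
    rintro ψ ⟨U, -, hψ⟩
    have hc : U.card < (Finset.univ : Finset (Fin n)).card := by
      rw [hψ.card, Finset.card_univ, Fintype.card_fin]
      exact he
    obtain ⟨c, -, hc⟩ := Finset.exists_mem_notMem_of_card_lt_card hc
    obtain ⟨i, t, ht, htψ⟩ := hψ.exists_harmonic_del (by omega) hc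
    obtain ⟨g, hg⟩ := exists_functional k (by omega) ht
    -- Composing with multiplication by `x_{i,c}` induces `del i c t = ψ` on words and kills the
    -- socle element `s`.
    refine ⟨g ∘ₗ LinearMap.mulLeft k (x k n i c), fun u => ?_, ?_⟩
    · rw [LinearMap.comp_apply, LinearMap.mulLeft_apply, x_mul_word, ← htψ, del_apply]
      split_ifs
      · exact hg _
      · exact map_zero g
    · rw [LinearMap.comp_apply, LinearMap.mulLeft_apply, (mem_socle_iff k).mp hsoc, map_zero]
  -- The truncation of `f` to weight `e` is also induced by some `g` with `g s = 0`; `f` and `g`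
  -- agree on the words that span degree `e`.
  obtain ⟨g, hg, hgs⟩ := hN (harmonic_mem_prodSpan e Finset.univ
    (by rw [Finset.card_univ, Fintype.card_fin]; omega) _
    (truncate_mem_harmonic (functional_mem_harmonic k (by omega) f) e)
    (fun u hu => if_neg hu) (fun j hj => absurd (Finset.mem_univ j) hj))
  have hfg : Set.EqOn f g {z | ∃ u : Fin n → Option (Fin (n - 1)), wt u = e ∧ word k u = z} := by
    rintro _ ⟨u, hu, rfl⟩
    exact ((hg u).trans (if_pos hu)).symm
  exact (LinearMap.eqOn_span hfg hs).trans hgs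

end LowDegree

/-! ### Young subgroup invariants and the socle. -/

section Symmetric

variable {k : Type*} [Field k] {n : ℕ}

variable (k) in
/-- The ideal generated by the `x_{i,j}` with `j ∈ S`. -/
def positionIdeal (S : Finset (Fin n)) : Ideal (GA k n) :=
  Ideal.span {z | ∃ i, ∃ j ∈ S, x k n i j = z}

theorem x_mem_positionIdeal (i : Fin (n - 1)) {S : Finset (Fin n)} {j : Fin n} (hj : j ∈ S) :
    x k n i j ∈ positionIdeal k S :=
  Ideal.subset_span ⟨i, j, hj, rfl⟩

theorem sup_pow_succ_le {R : Type*} [CommRing R] (I J : Ideal R) (hJ : J * J = ⊥) (m : ℕ) :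
    (I ⊔ J) ^ (m + 1) ≤ I ^ (m + 1) ⊔ I ^ m * J := by
  induction m with
  | zero => simp
  | succ m ih =>
    rw [pow_succ]
    refine (Ideal.mul_mono_left ih).trans ?_
    rw [Ideal.mul_sup, Ideal.sup_mul, Ideal.sup_mul, mul_assoc (I ^ m) J J, hJ, Ideal.mul_bot,
      sup_bot_eq, ← pow_succ, mul_assoc (I ^ m), mul_comm J I, ← mul_assoc, ← pow_succ]
    exact sup_le (sup_le le_sup_left le_sup_right) le_sup_right

/-- Two generators at the same position multiply to zero, so a nonzero product of generators has at
most one factor per position. -/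
theorem positionIdeal_pow (S : Finset (Fin n)) : positionIdeal k S ^ (S.card + 1) = ⊥ := by
  induction S using Finset.induction_on with
  | empty => simp [positionIdeal]
  | insert j S hj ih =>
    set J : Ideal (GA k n) := Ideal.span (Set.range fun i => x k n i j) with hJ
    have h1 : positionIdeal k (insert j S) ≤ positionIdeal k S ⊔ J := by
      rw [positionIdeal, Ideal.span_le]
      rintro _ ⟨i, l, hl, rfl⟩
      rcases Finset.mem_insert.mp hl with rfl | hl
      · exact Ideal.mem_sup_right (Ideal.subset_span ⟨i, rfl⟩)
      · exact Ideal.mem_sup_left (x_mem_positionIdeal i hl)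
    have h2 : J * J = ⊥ := by
      rw [hJ, Ideal.span_mul_span', Ideal.span_eq_bot]
      rintro _ ⟨_, ⟨i, rfl⟩, _, ⟨i', rfl⟩, rfl⟩
      exact x_mul_x k i i' j
    rw [Finset.card_insert_of_notMem hj, eq_bot_iff]
    refine (Ideal.pow_right_mono h1 _).trans ((sup_pow_succ_le _ _ h2 _).trans ?_)
    rw [pow_succ (positionIdeal k S) (S.card + 1), ih, Ideal.bot_mul, Ideal.bot_mul, sup_bot_eq]

theorem GArep_apply_mul (σ : Equiv.Perm (Fin n)) (y z : GA k n) :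
    GArep k n σ (y * z) = GArep k n σ y * GArep k n σ z :=
  map_mul (permClosure k (AlgA k n) σ) y z

theorem GArep_word (σ : Equiv.Perm (Fin n)) (u : Fin n → Option (Fin (n - 1))) :
    GArep k n σ (word k u) = word k (fun j => u (σ⁻¹ j)) := by
  change Ideal.Quotient.mk _ (permTensor k (AlgA k n) σ _) = _
  rw [tensorWord, permTensor_tprod]
  rfl

/-- The permutations that preserve the fibers of `r`. -/
def fiberPerms (r : Fin n → ℕ) : Finset (Equiv.Perm (Fin n)) :=
  Finset.univ.filter fun σ => ∀ a, r (σ a) = r a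

theorem mem_fiberPerms {r : Fin n → ℕ} {σ : Equiv.Perm (Fin n)} :
    σ ∈ fiberPerms r ↔ ∀ a, r (σ a) = r a := by
  simp [fiberPerms]

variable (k) in
/-- The sum over all permutations that preserve the fibers of `r`. -/
def fiberSum (r : Fin n → ℕ) : GA k n →ₗ[k] GA k n := ∑ σ ∈ fiberPerms r, GArep k n σ

theorem fiberSum_apply (r : Fin n → ℕ) (z : GA k n) :
    fiberSum k r z = ∑ σ ∈ fiberPerms r, GArep k n σ z := by
  simp [fiberSum, LinearMap.sum_apply]

theorem fiberSum_GArep {r : Fin n → ℕ} {τ : Equiv.Perm (Fin n)} (hτ : ∀ a, r (τ a) = r a)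
    (z : GA k n) : fiberSum k r (GArep k n τ z) = fiberSum k r z := by
  rw [fiberSum_apply, fiberSum_apply]
  refine Finset.sum_equiv (Equiv.mulRight τ) (fun σ => ?_) fun σ _ => ?_
  · rw [mem_fiberPerms, mem_fiberPerms]
    simp only [Equiv.coe_mulRight, Equiv.Perm.mul_apply]
    refine ⟨fun h a => (h _).trans (hτ a), fun h a => ?_⟩
    have h1 := h (τ⁻¹ a)
    have h2 := hτ (τ⁻¹ a)
    rw [show τ (τ⁻¹ a) = a from τ.apply_symm_apply a] at h1 h2
    rw [h1, h2]
  · rw [Equiv.coe_mulRight, map_mul]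
    rfl

/-- The sum of the `x_{i,j}` over the fiber of `r` above `ρ`. -/
def fiberX (r : Fin n → ℕ) (i : Fin (n - 1)) (ρ : ℕ) : GA k n :=
  ∑ j ∈ Finset.univ.filter (fun j => r j = ρ), x k n i j

theorem GArep_fiberX {r : Fin n → ℕ} {σ : Equiv.Perm (Fin n)} (hσ : ∀ a, r (σ a) = r a)
    (i : Fin (n - 1)) (ρ : ℕ) : GArep k n σ (fiberX r i ρ) = fiberX r i ρ := by
  rw [fiberX, map_sum]
  refine Finset.sum_equiv σ (fun j => ?_) fun j _ => GArep_x k n σ i j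
  simp [hσ]

theorem fiberX_mul_fiberSum (r : Fin n → ℕ) (i : Fin (n - 1)) (ρ : ℕ) (z : GA k n) :
    fiberX r i ρ * fiberSum k r z = fiberSum k r (fiberX r i ρ * z) := by
  rw [fiberSum_apply, fiberSum_apply, Finset.mul_sum]
  refine Finset.sum_congr rfl fun σ hσ => ?_
  rw [GArep_apply_mul, GArep_fiberX (mem_fiberPerms.mp hσ)]

variable [CharZero k]

/-- The symmetrization of a word is a multiple of a product of fiber sums. -/
theorem fiberSum_word_mem (r : Fin n → ℕ) {J : Ideal (GA k n)} (hJ : ∀ i ρ, fiberX r i ρ ∈ J)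
    (e : ℕ) : ∀ u : Fin n → Option (Fin (n - 1)), wt u = e → fiberSum k r (word k u) ∈ J ^ e := by
  induction e with
  | zero => simp
  | succ e ih =>
    intro u hu
    obtain ⟨j, hj⟩ : (Finset.univ.filter fun j => u j ≠ none).Nonempty :=
      Finset.card_pos.mp (by rw [wt] at hu; omega)
    replace hj : u j ≠ none := (Finset.mem_filter.mp hj).2
    obtain ⟨i, hi⟩ := Option.ne_none_iff_exists'.mp hj
    set v := Function.update u j none with hv
    have hvj : v j = none := by simp [hv]
    have huv : Function.update v j (some i) = u := by
      rw [hv, Function.update_idem, ← hi, Function.update_eq_self]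
    have hwt : wt v = e := by
      have := wt_update_none hj
      rw [← hv] at this
      omega
    -- Multiplying `v` by the block sum writes `i` into each blank position of the block of `j`.
    -- Swaps inside the block identify the resulting words with `u`, so all have the same
    -- symmetrization, and `|T|` is nonzero in `k`.
    set T := Finset.univ.filter fun l => r l = r j ∧ v l = none with hT
    have hjT : j ∈ T := by simp [hT, hvj]
    have key : fiberX r i (r j) * fiberSum k r (word k v) =
        (T.card : k) • fiberSum k r (word k u) := by
      rw [fiberX_mul_fiberSum, fiberX, Finset.sum_mul]
      simp_rw [x_mul_word]
      rw [← Finset.sum_filter, Finset.filter_filter, map_sum, ← hT]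
      refine Eq.trans ?_ (Nat.cast_smul_eq_nsmul (M := GA k n) k _ _).symm
      refine Finset.sum_eq_card_nsmul fun l hl => ?_
      obtain ⟨hl1, hl2⟩ : r l = r j ∧ v l = none := by simpa [hT] using hl
      rw [← fiberSum_GArep (τ := Equiv.swap l j), GArep_word]
      · congr 2
        rw [← huv]
        ext1 m
        rw [Equiv.swap_inv]
        rcases eq_or_ne m l with rfl | hml
        · rw [Equiv.swap_apply_left]
          rcases eq_or_ne m j with rfl | hmj
          · rfl
          · rw [Function.update_of_ne hmj.symm, Function.update_of_ne hmj, hvj, hl2]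
        · rcases eq_or_ne m j with rfl | hmj
          · rw [Equiv.swap_apply_right, Function.update_self, Function.update_self]
          · rw [Equiv.swap_apply_of_ne_of_ne hml hmj, Function.update_of_ne hml,
              Function.update_of_ne hmj]
      · intro a
        rcases eq_or_ne a l with rfl | hal
        · rw [Equiv.swap_apply_left, hl1]
        · rcases eq_or_ne a j with rfl | haj
          · rw [Equiv.swap_apply_right, hl1]
          · rw [Equiv.swap_apply_of_ne_of_ne hal haj]
    have hc : (T.card : k) ≠ 0 := Nat.cast_ne_zero.mpr (Finset.card_pos.mpr ⟨j, hjT⟩).ne'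
    have h1 : fiberSum k r (word k u) =
        (T.card : k)⁻¹ • (fiberX r i (r j) * fiberSum k r (word k v)) := by
      rw [key, smul_smul, inv_mul_cancel₀ hc, one_smul]
    rw [h1, pow_succ' J e]
    exact Submodule.smul_of_tower_mem _ _ (Ideal.mul_mem_mul (hJ i _) (ih v hwt))

/-- The sum over the block `ρ` is minus the sum over its complement, so all block sums lie in the
ideal of positions outside `ρ`. An invariant element is, up to a nonzero scalar, its own
symmetrization. -/
theorem mem_positionIdeal_pow (hn : 1 ≤ n) {r : Fin n → ℕ} {e : ℕ} {z : GA k n}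
    (hz : z ∈ wordSpan k n e)
    (hinv : ∀ σ : Equiv.Perm (Fin n), (∀ a, r (σ a) = r a) → GArep k n σ z = z) (ρ : ℕ) :
    z ∈ positionIdeal k (Finset.univ.filter fun j => r j ≠ ρ) ^ e := by
  set S := Finset.univ.filter fun j => r j ≠ ρ with hS
  have hJ : ∀ i ρ', fiberX r i ρ' ∈ positionIdeal k S := by
    intro i ρ'
    by_cases h : ρ' = ρ
    · have h1 := sum_x k hn i
      rw [← Finset.sum_filter_add_sum_filter_not Finset.univ (fun j => r j = ρ)] at h1
      rw [h, fiberX, eq_neg_of_add_eq_zero_left h1]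
      exact neg_mem (Submodule.sum_mem _ fun j hj => x_mem_positionIdeal i hj)
    · refine Submodule.sum_mem _ fun j hj => x_mem_positionIdeal i ?_
      have : r j = ρ' := by simpa using hj
      simp [hS, this, h]
  have h1 : fiberSum k r z ∈ positionIdeal k S ^ e := by
    refine Submodule.span_induction (p := fun z _ => fiberSum k r z ∈ positionIdeal k S ^ e)
      ?_ ?_ ?_ ?_ hz
    · rintro _ ⟨u, hu, rfl⟩
      exact fiberSum_word_mem r hJ e u hu
    · rw [map_zero]; exact Submodule.zero_mem _
    · intro y z _ _ hy hz
      rw [map_add]; exact Submodule.add_mem _ hy hz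
    · intro c y _ hy
      rw [map_smul]; exact Submodule.smul_of_tower_mem _ _ hy
  have h2 : fiberSum k r z = ((fiberPerms r).card : k) • z := by
    rw [fiberSum_apply]
    refine Eq.trans ?_ (Nat.cast_smul_eq_nsmul (M := GA k n) k _ _).symm
    exact Finset.sum_eq_card_nsmul fun σ hσ => hinv σ (mem_fiberPerms.mp hσ)
  have hc : ((fiberPerms r).card : k) ≠ 0 :=
    Nat.cast_ne_zero.mpr (Finset.card_pos.mpr ⟨1, mem_fiberPerms.mpr fun _ => rfl⟩).ne'
  have h3 : z = ((fiberPerms r).card : k)⁻¹ • fiberSum k r z := by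
    rw [h2, smul_smul, inv_mul_cancel₀ hc, one_smul]
  rw [h3]
  exact Submodule.smul_of_tower_mem _ _ h1

/-- An element that is invariant under a Young subgroup with two blocks of size `n - e`, where `e`
is its degree, lies in the socle. -/
theorem mem_socle_of_invariant (hn : 1 ≤ n) {r : Fin n → ℕ} {e : ℕ} {z : GA k n}
    (hz : z ∈ wordSpan k n e)
    (hinv : ∀ σ : Equiv.Perm (Fin n), (∀ a, r (σ a) = r a) → GArep k n σ z = z) {ρ ρ' : ℕ}
    (hρ : ρ ≠ ρ') (h1 : (Finset.univ.filter fun j => r j = ρ).card + e = n)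
    (h2 : (Finset.univ.filter fun j => r j = ρ').card + e = n) : z ∈ socle k n := by
  -- The complement of the block has `e` positions. For `j` in it, `x_{i,j} z` lies in the `(e +
  -- 1)`-st power of its ideal, which is zero. No `j` lies in both blocks, so one of them always
  -- applies.
  have key : ∀ ρ, (Finset.univ.filter fun j => r j = ρ).card + e = n →
      ∀ i j, r j ≠ ρ → x k n i j * z = 0 := by
    intro ρ h i j hj
    have hc : (Finset.univ.filter fun j => r j ≠ ρ).card = e := by
      have := Finset.card_filter_add_card_filter_not (s := Finset.univ) (fun j => r j = ρ)
      rw [Finset.card_univ, Fintype.card_fin] at this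
      simp only [ne_eq]
      omega
    have h3 := Ideal.mul_mem_mul
      (x_mem_positionIdeal (k := k) i (S := Finset.univ.filter fun j => r j ≠ ρ) (j := j)
        (by simpa using hj)) (mem_positionIdeal_pow hn hz hinv ρ)
    rw [← pow_succ' (positionIdeal k (Finset.univ.filter fun j => r j ≠ ρ)) e] at h3
    have h4 := positionIdeal_pow (k := k) (Finset.univ.filter fun j => r j ≠ ρ)
    rw [hc] at h4
    rw [h4] at h3
    exact h3
  rw [mem_socle_iff]
  intro i j
  by_cases h : r j = ρ
  · exact key ρ' h2 i j (h ▸ hρ)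
  · exact key ρ h1 i j h

end Symmetric

open SpechtModule

/-! ### Row lengths of the shape `μ`. -/

section Shape

theorem card_filter_rowOf {μ : YoungDiagram} {n : ℕ} (t : Tableau μ n) (ρ : ℕ) :
    (Finset.univ.filter fun j => rowOf t j = ρ).card = μ.rowLen ρ := by
  rw [YoungDiagram.rowLen_eq_card]
  refine Finset.card_bij (fun j _ => (t.symm j).1) ?_ ?_ ?_
  · intro j hj
    rw [YoungDiagram.mem_row_iff]
    exact ⟨(t.symm j).2, (Finset.mem_filter.mp hj).2⟩
  · intro j _ j' _ h
    exact t.symm.injective (Subtype.ext h)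
  · intro c hc
    rw [YoungDiagram.mem_row_iff] at hc
    refine ⟨t ⟨c, hc.1⟩, ?_, by simp⟩
    rw [Finset.mem_filter, rowOf, Equiv.symm_apply_apply]
    exact ⟨Finset.mem_univ _, hc.2⟩

/-- This is the only property of `μ` that the socle argument uses. -/
theorem rowLen_socleShape {n : ℕ} (hn : 4 ≤ n) {ρ : ℕ} (hρ : ρ < 2) :
    (socleShape n hn).rowLen ρ + socleDegree n = n := by
  rw [socleShape]
  split_ifs with h
  · obtain ⟨m, rfl⟩ := h
    have hd : socleDegree (m + m) = m := by rw [socleDegree]; omega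
    have := YoungDiagram.rowLen_ofRowLens (w := [socleDegree (m + m), socleDegree (m + m)])
      (hw := by simp [List.sortedGE_iff_pairwise]) ⟨ρ, hρ⟩
    simp only at this
    rw [this]
    interval_cases ρ <;> simp [hd]
  · obtain ⟨m, rfl⟩ := Nat.not_even_iff_odd.mp h
    have hd : socleDegree (2 * m + 1) = m + 1 := by rw [socleDegree]; omega
    have := YoungDiagram.rowLen_ofRowLens
      (w := [socleDegree (2 * m + 1) - 1, socleDegree (2 * m + 1) - 1, 1])
      (hw := by simp [List.sortedGE_iff_pairwise, hd]; omega) ⟨ρ, by simp; omega⟩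
    simp only at this
    rw [this]
    interval_cases ρ <;> simp [hd] <;> omega

end Shape

/-! ### Copies of the Specht module in the socle. -/

section SpechtSocle

variable {k : Type*} [Field k] [CharZero k] {n : ℕ}

/-- The image of `V_μ` under an equivariant map is spanned by elements `w_t`, for `t` a tableau of
shape `μ`, such that `w_t` is invariant under the row stabilizer of `t`. -/
theorem specht_le_span_row_invariants {μ : YoungDiagram} {M : Type*} [AddCommGroup M] [Module k M]
    (ρ : Representation k (Equiv.Perm (Fin n)) M) (N : Submodule k M)
    (F : (specht k μ n).toSubmodule →ₗ[k] M)
    (hF : ∀ σ v, F ((specht k μ n).toRepresentation σ v) = ρ σ (F v))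
    (hN : ∀ (t : Tableau μ n) (v : (specht k μ n).toSubmodule),
      (∀ σ : Equiv.Perm (Fin n), (∀ a, rowOf t (σ a) = rowOf t a) → ρ σ (F v) = F v) → F v ∈ N)
    (v : (specht k μ n).toSubmodule) : F v ∈ N := by
  have : NeZero (Nat.card (Equiv.Perm (Fin n)) : k) :=
    ⟨Nat.cast_ne_zero.mpr Nat.card_pos.ne'⟩
  -- Maschke's theorem: the projection along an invariant complement makes `V_μ` an equivariant
  -- quotient of `M_μ`.
  obtain ⟨C, hC⟩ := exists_isCompl (specht k μ n)
  have hcompl : IsCompl (specht k μ n).toSubmodule C.toSubmodule := by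
    constructor
    · rw [disjoint_iff]
      exact congrArg Subrepresentation.toSubmodule (disjoint_iff.mp hC.1)
    · rw [codisjoint_iff]
      exact congrArg Subrepresentation.toSubmodule (codisjoint_iff.mp hC.2)
  let p := (specht k μ n).toSubmodule.projectionOnto C.toSubmodule hcompl
  have hp : ∀ σ m, p (permRep k μ n σ m) = (specht k μ n).toRepresentation σ (p m) := by
    intro σ m
    obtain ⟨y, hy, z, hz, rfl⟩ : ∃ y ∈ (specht k μ n).toSubmodule, ∃ z ∈ C.toSubmodule,
        y + z = m := by
      rw [← Submodule.mem_sup, hcompl.sup_eq_top]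
      trivial
    have h1 : p (y + z) = ⟨y, hy⟩ := by
      rw [map_add, Submodule.projectionOnto_apply_of_mem_right hcompl hz, add_zero]
      exact Submodule.projectionOnto_apply_left hcompl ⟨y, hy⟩
    rw [h1, map_add, map_add, Submodule.projectionOnto_apply_of_mem_right hcompl
      (C.apply_mem_toSubmodule σ hz), add_zero]
    exact Submodule.projectionOnto_apply_left hcompl
      ⟨_, (specht k μ n).apply_mem_toSubmodule σ hy⟩
  have key : ∀ m, F (p m) ∈ N := by
    intro m
    induction m using Finsupp.induction_linear with
    | zero => simp
    | add m m' h h' => rw [map_add, map_add]; exact Submodule.add_mem _ h h'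
    | single T c =>
      induction T using Quotient.inductionOn with
      | h t =>
        -- The row stabilizer fixes the tabloid `{t}`, hence also its equivariant image.
        refine hN t _ fun σ hσ => ?_
        rw [← hF, ← hp]
        congr 2
        have h : σ • Tabloid.mk t = Tabloid.mk t := by
          refine Quotient.sound ?_
          change rowOf (act σ t) = rowOf t
          rw [rowOf_act]
          ext1 a
          rw [← hσ (σ⁻¹ a)]
          exact congrArg _ (σ.apply_symm_apply a)
        change Finsupp.mapDomain (fun T : Tabloid μ n => σ • T) (Finsupp.single (Tabloid.mk t) c) =
          Finsupp.single (Tabloid.mk t) c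
        rw [Finsupp.mapDomain_single, h]
  have h := key v
  rwa [show p v = v from Submodule.projectionOnto_apply_left hcompl v] at h

theorem subrepresentation_le_socle (hn : 4 ≤ n) (W : Subrepresentation (GArep k n))
    (hW : W.toSubmodule ≤ wordSpan k n (socleDegree n))
    (e : (specht k (socleShape n hn) n).toRepresentation.Equiv W.toRepresentation) {s : GA k n}
    (hs : s ∈ W.toSubmodule) : s ∈ socle k n := by
  have key := specht_le_span_row_invariants (GArep k n) ((socle k n).restrictScalars k)
    (W.toSubmodule.subtype ∘ₗ e.toLinearEquiv.toLinearMap) (fun σ v => ?_) (fun t v hv => ?_)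
    (e.toLinearEquiv.symm ⟨s, hs⟩)
  · rw [LinearMap.comp_apply, LinearEquiv.coe_coe, LinearEquiv.apply_symm_apply] at key
    exact key
  · have h := LinearMap.congr_fun (e.isIntertwining' σ) v
    exact congrArg Subtype.val h
  · exact mem_socle_of_invariant (r := rowOf t) (by omega) (hW (e.toLinearEquiv v).2) hv
      zero_ne_one (by rw [card_filter_rowOf, rowLen_socleShape hn (by omega)])
      (by rw [card_filter_rowOf, rowLen_socleShape hn (by omega)])

end SpechtSocle

/-! ### A nonzero socle element in degree `D`. -/

section Existence

variable (k : Type*) [Field k] {n : ℕ}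

theorem word_mem_degPart (e : ℕ) : ∀ u : Fin n → Option (Fin (n - 1)), wt u = e →
    word k u ∈ degPart k n e := by
  induction e with
  | zero =>
    intro u hu
    have h : u = fun _ => none := by
      rw [wt, Finset.card_eq_zero, Finset.filter_eq_empty_iff] at hu
      ext1 j
      simpa using hu (Finset.mem_univ j)
    refine ⟨1, MvPolynomial.isHomogeneous_one _ _, ?_⟩
    rw [h, word_none]
    exact map_one (pres k n)
  | succ e ih =>
    intro u hu
    obtain ⟨j, hj⟩ : (Finset.univ.filter fun j => u j ≠ none).Nonempty :=
      Finset.card_pos.mp (by rw [wt] at hu; omega)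
    replace hj : u j ≠ none := (Finset.mem_filter.mp hj).2
    obtain ⟨i, hi⟩ := Option.ne_none_iff_exists'.mp hj
    obtain ⟨q, hq, hqu⟩ := ih (Function.update u j none)
      (by have := wt_update_none hj; omega)
    refine ⟨MvPolynomial.X (i, j) * q, ?_, ?_⟩
    · rw [SetLike.mem_coe, MvPolynomial.mem_homogeneousSubmodule, add_comm]
      exact (MvPolynomial.isHomogeneous_X k (i, j)).mul hq
    · have h2 : pres k n (MvPolynomial.X (i, j)) = x k n i j := MvPolynomial.aeval_X _ _
      change pres k n _ = _
      rw [map_mul, h2]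
      change _ * (pres k n).toLinearMap q = _
      rw [hqu, x_mul_word, if_pos (Function.update_self ..), Function.update_idem, ← hi,
        Function.update_eq_self]

/-- The word with the letter `a` in the first `e` positions. -/
def initialWord {L : Type*} (a : L) (e : ℕ) : Fin n → Option L :=
  fun j => if (j : ℕ) < e then some a else none

variable {k} in
theorem pair_initialWord {L : Type*} [DecidableEq L] (a : L) (ψ : (Fin n → Option L) → k) {e : ℕ}
    {j l : Fin n} (hj : (j : ℕ) = e) (hl : e < l) :
    pair a j l ψ (initialWord a (e + 1)) = ψ (initialWord a e) := by
  have h2 : initialWord a (e + 1) j = some a := by simp [initialWord, hj]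
  have h3 : initialWord a (e + 1) l ≠ some a := by
    simp only [initialWord]
    rw [if_neg (by omega)]
    simp
  have h4 : Function.update (initialWord a (e + 1)) j none = initialWord a e := by
    ext1 q
    rcases eq_or_ne q j with rfl | hq
    · simp [initialWord, hj]
    · have : (q : ℕ) ≠ e := fun h => hq (Fin.ext (h.trans hj.symm))
      rw [Function.update_of_ne hq]
      simp only [initialWord]
      congr 1
      rw [eq_iff_iff]
      omega
  rw [pair_apply, Pi.sub_apply, ins_apply, ins_apply, if_pos h2, if_neg h3, h4, sub_zero]

/-- Position `i` is paired with `m + i` for each `i < e`. At the initial word only the summand with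
every letter in the first half contributes. -/
theorem exists_isProd_initialWord {L : Type*} [DecidableEq L] (a : L) {m : ℕ} (hm : 2 * m ≤ n)
    (e : ℕ) (he : e ≤ m) : ∃ (U : Finset (Fin n)) (ψ : (Fin n → Option L) → k), IsProd U e ψ ∧
      (∀ j ∈ U, (j : ℕ) < e ∨ m ≤ j ∧ (j : ℕ) < m + e) ∧ ψ (initialWord a e) = 1 := by
  induction e with
  | zero =>
    refine ⟨∅, _, .empty, by simp, ?_⟩
    have : (initialWord a 0 : Fin n → Option L) = fun _ => none := by
      ext1 j; simp [initialWord]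
    rw [this, emptyWord, Pi.single_eq_same]
  | succ e ih =>
    obtain ⟨U, ψ, hψ, hU, h1⟩ := ih (by omega)
    let j : Fin n := ⟨e, by omega⟩
    let l : Fin n := ⟨m + e, by omega⟩
    have hj : j ∉ U := fun h => by have := hU j h; simp only [j] at this; omega
    have hl : l ∉ U := fun h => by have := hU l h; simp only [l] at this; omega
    have hjl : j ≠ l := fun h => by have := congrArg Fin.val h; simp only [j, l] at this; omega
    refine ⟨_, _, hψ.step a hj hl hjl, ?_, ?_⟩
    · intro q hq
      rcases Finset.mem_insert.mp hq with rfl | hq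
      · left; simp [j]
      · rcases Finset.mem_insert.mp hq with rfl | hq
        · right; simp only [l]; omega
        · have := hU q hq; omega
    · rw [pair_initialWord a ψ (show (j : ℕ) = e from rfl) (show e < m + e by omega), h1]

/-- The last pair is kept explicit so that, for odd `n`, it can be replaced by a triple through the
remaining position. -/
theorem exists_isProd_pair_initialWord {L : Type*} [DecidableEq L] (a : L) {m : ℕ}
    (hm : 2 * m ≤ n) (e : ℕ) (he : e < m) :
    ∃ (U : Finset (Fin n)) (ψ : (Fin n → Option L) → k) (j l : Fin n), IsProd U e ψ ∧
      (∀ j ∈ U, (j : ℕ) < 2 * m) ∧ j ∉ U ∧ l ∉ U ∧ j ≠ l ∧ ((j : ℕ) < 2 * m ∧ (l : ℕ) < 2 * m) ∧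
      pair a j l ψ (initialWord a (e + 1)) = 1 := by
  obtain ⟨U, ψ, hψ, hU, h1⟩ := exists_isProd_initialWord k a hm e he.le
  let j : Fin n := ⟨e, by omega⟩
  let l : Fin n := ⟨m + e, by omega⟩
  refine ⟨U, ψ, j, l, hψ, fun i hi => ?_, fun h => ?_, fun h => ?_, fun h => ?_, ?_, ?_⟩
  · have := hU i hi; omega
  · have := hU j h; simp only [j] at this; omega
  · have := hU l h; simp only [l] at this; omega
  · have := congrArg Fin.val h; simp only [j, l] at this; omega
  · simp only [j, l]; omega
  · rw [pair_initialWord a ψ (show (j : ℕ) = e from rfl) (show e < m + e by omega), h1]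

variable [CharZero k]

theorem word_ne_zero (hn : 1 ≤ n) {φ : (Fin n → Option (Fin (n - 1))) → k}
    (hφ : φ ∈ harmonic k (Fin (n - 1)) (Fin n)) {u : Fin n → Option (Fin (n - 1))}
    (hu : φ u ≠ 0) : word k u ≠ 0 := by
  obtain ⟨f, hf⟩ := exists_functional k hn hφ
  intro h
  rw [← hf, h, map_zero] at hu
  exact hu rfl

theorem card_filter_of_iff {p : Fin n → Prop} [DecidablePred p] {a b : ℕ} (hb : b ≤ n)
    (h : ∀ j, p j ↔ a ≤ (j : ℕ) ∧ (j : ℕ) < b) : (Finset.univ.filter p).card = b - a := by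
  simp_rw [h]
  rw [Finset.card_filter, Fin.sum_univ_eq_sum_range (fun j => if a ≤ j ∧ j < b then 1 else 0) n,
    ← Finset.card_filter, ← Nat.card_Ico]
  congr 1
  ext j
  simp only [Finset.mem_filter, Finset.mem_range, Finset.mem_Ico]
  omega

theorem wt_initialWord {L : Type*} (a : L) {e : ℕ} (he : e ≤ n) :
    wt (initialWord a e : Fin n → Option L) = e :=
  card_filter_of_iff (a := 0) he fun j => by simp [initialWord]

/-- A word that is constant on the fibers of `r` lies in the socle if two of the fibers have
`n - e` elements, where `e` is the number of its letters. -/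
theorem word_mem_socle (hn : 1 ≤ n) {r : Fin n → ℕ} {u : Fin n → Option (Fin (n - 1))}
    (hu : ∀ a b, r a = r b → u a = u b) {ρ ρ' : ℕ} (hρ : ρ ≠ ρ')
    (h1 : (Finset.univ.filter fun j => r j = ρ).card + wt u = n)
    (h2 : (Finset.univ.filter fun j => r j = ρ').card + wt u = n) : word k u ∈ socle k n := by
  refine mem_socle_of_invariant hn (Submodule.subset_span ⟨u, rfl, rfl⟩) (fun σ hσ => ?_) hρ h1 h2
  rw [GArep_word]
  congr 1
  ext1 j
  refine hu _ _ ?_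
  rw [← hσ (σ⁻¹ j)]
  exact congrArg r (σ.apply_symm_apply j)

theorem exists_socle_ne_zero (hn : 4 ≤ n) :
    ∃ s ∈ degPart k n (socleDegree n), s ∈ socle k n ∧ s ≠ 0 := by
  suffices ∃ u : Fin n → Option (Fin (n - 1)), wt u = socleDegree n ∧ word k u ∈ socle k n ∧
      ∃ φ ∈ harmonic k (Fin (n - 1)) (Fin n), φ u ≠ 0 by
    obtain ⟨u, hu, hs, φ, hφ, h⟩ := this
    exact ⟨word k u, word_mem_degPart k _ u hu, hs, word_ne_zero k (by omega) hφ h⟩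
  let a : Fin (n - 1) := ⟨0, by omega⟩
  let b : Fin (n - 1) := ⟨1, by omega⟩
  have hba : b ≠ a := fun h => by have := congrArg Fin.val h; simp [a, b] at this
  rcases Nat.even_or_odd' n with ⟨m, hm | hm⟩
  · have hD : socleDegree n = m := by rw [socleDegree]; omega
    obtain ⟨U, ψ, hψ, -, h1⟩ := exists_isProd_initialWord k (n := n) a (m := m) (by omega) m le_rfl
    have hwt : wt (initialWord a m : Fin n → _) = m := wt_initialWord a (by omega)
    -- For `n = 2m` the two halves serve as the blocks, each of size `m = n - D`.
    refine ⟨initialWord a m, by rw [hwt, hD], ?_, ψ, hψ.mem_harmonic, by simp [h1]⟩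
    refine word_mem_socle k (r := fun j => if (j : ℕ) < m then 0 else 1) (by omega) ?_
      zero_ne_one ?_ ?_
    · intro i j h
      simp only [initialWord]
      split_ifs at h ⊢ <;> rfl
    · refine (congrArg (· + _)
        (card_filter_of_iff (a := 0) (b := m) (by omega) fun j => ?_)).trans ?_
      · split_ifs <;> simp <;> omega
      · simp only [hwt]; omega
    · refine (congrArg (· + _)
        (card_filter_of_iff (a := m) (b := n) le_rfl fun j => ?_)).trans ?_
      · split_ifs <;> simp <;> omega
      · simp only [hwt]; omega
  · have hD : socleDegree n = m + 1 := by rw [socleDegree]; omega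
    obtain ⟨e, rfl⟩ : ∃ e, m = e + 1 := ⟨m - 1, by omega⟩
    obtain ⟨U, ψ, j, l, hψ, hU, hj, hl, hjl, hjl', h1⟩ :=
      exists_isProd_pair_initialWord k (n := n) a (m := e + 1) (by omega) e (by omega)
    -- For `n = 2(e + 1) + 1` the word has `a` in the first `e + 1` positions and a different letter
    -- `b` in the last position `c`. The blocks have sizes `e + 1`, `e + 1` and `1`.
    let c : Fin n := ⟨2 * (e + 1), by omega⟩
    have hcU : c ∉ U := fun h => by have := hU c h; simp only [c] at this; omega
    have hcj : c ≠ j := fun h => by have := congrArg Fin.val h; simp only [c] at this; omega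
    have hcl : c ≠ l := fun h => by have := congrArg Fin.val h; simp only [c] at this; omega
    have hc : initialWord a (e + 1) c = none := if_neg (by simp only [c]; omega)
    have hwt : wt (Function.update (initialWord a (e + 1)) c (some b)) = e + 1 + 1 := by
      rw [wt_update_some hc, wt_initialWord a (by omega)]
    refine ⟨Function.update (initialWord a (e + 1)) c (some b), by rw [hwt, hD], ?_,
      triple b a c j l ψ, triple_mem_harmonic hψ.mem_harmonic (hψ.avoids hcU) (hψ.avoids hj)
        (hψ.avoids hl) hcj hcl hjl b a, ?_⟩
    · refine word_mem_socle k
        (r := fun j => if (j : ℕ) < e + 1 then 0 else if (j : ℕ) < 2 * (e + 1) then 1 else 2)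
        (by omega) ?_ zero_ne_one ?_ ?_
      · intro i j h
        have hv : ∀ i : Fin n, i = c ↔ (i : ℕ) = 2 * (e + 1) := fun i => Fin.ext_iff
        simp only [Function.update_apply, hv, initialWord]
        split_ifs at h ⊢ <;> first | rfl | omega
      · refine (congrArg (· + _)
          (card_filter_of_iff (a := 0) (b := e + 1) (by omega) fun j => ?_)).trans ?_
        · split_ifs <;> simp <;> omega
        · simp only [hwt]; omega
      · refine (congrArg (· + _)
          (card_filter_of_iff (a := e + 1) (b := 2 * (e + 1)) (by omega) fun j => ?_)).trans ?_
        · split_ifs <;> simp <;> omega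
        · simp only [hwt]; omega
    · have h2 := congrFun (del_triple (hψ.avoids hcU) hcj hcl hba) (initialWord a (e + 1))
      rw [del_apply, if_pos hc, h1] at h2
      rw [h2]
      exact one_ne_zero

end Existence

end GaloisClosure

theorem theorem4p1 (k : Type*) [Field k] [CharZero k] (n : ℕ) (hn : 4 ≤ n) :
    -- the least degree of a nonzero homogeneous socle element is `D`
    IsLeast {e : ℕ | ∃ s ∈ GaloisClosure.degPart k n e, s ∈ GaloisClosure.socle k n ∧ s ≠ 0}
      (GaloisClosure.socleDegree n) ∧
    -- every copy of `V_μ` in a component of multidegree `d` with `∑ dᵢ = D` lies in the socle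
    ∀ d : Fin (n - 1) → ℕ, ∑ i, d i = GaloisClosure.socleDegree n →
      ∀ W : Subrepresentation (GaloisClosure.GArep k n),
        W.toSubmodule ≤ GaloisClosure.multiPart k n d →
        Nonempty ((SpechtModule.specht k (GaloisClosure.socleShape n hn) n).toRepresentation.Equiv
          W.toRepresentation) →
        ∀ s ∈ W.toSubmodule, s ∈ GaloisClosure.socle k n := by
  refine ⟨⟨GaloisClosure.exists_socle_ne_zero k hn, ?_⟩, ?_⟩
  · rintro e ⟨s, hs, hsoc, hne⟩
    by_contra h
    refine hne (GaloisClosure.eq_zero_of_mem_socle (by omega) (e := e) ?_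
      (GaloisClosure.degPart_le_wordSpan k e hs) hsoc)
    rw [GaloisClosure.socleDegree] at h
    omega
  · rintro d hd W hW ⟨e⟩ s hs
    refine GaloisClosure.subrepresentation_le_socle hn W (hW.trans ?_) e hs
    rw [← hd]
    exact (GaloisClosure.multiPart_le_degPart k d).trans (GaloisClosure.degPart_le_wordSpan k _)
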